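/- **Setting.** Let $G$ be a finite directed graph with distinct nodes $s$ (source) and $t$ (sink); every node has one antenna. All edges of $G$ carry i.i.d. fading coefficients $h_{uv}\sim\mathcal{CN}(0,1)$ that stay fixed during the transmission; all receiver noises are i.i.d. $\mathcal{CN}(0,1)$. In every time slot a node $v$ receives $\sum_{u\to v} h_{uv}z_u+w_v$, where $z_u$ is the symbol sent by $u$ ($0$ if $u$ is silent) and $w_v$ is noise. An amplify-and-forward (AF) protocol $\wp$ consists of a number $n\ge 1$ of slots, a schedule saying in which slots each node transmits and listens (nodes are full-duplex: they may do both in the same slot), and a constant scaling factor $a_v>0$ for each relay. A transmitting relay sends $a_v$ times the symbol it most recently received while listening, in an earlier slot ($0$ if there is none); the source sends its own symbols $x\in\mathbb C^n$; the sink only listens. This induces a channel $y=H_\wp x+z$, where, given the fading, the noise $z$ is Gaussian with covariance $K_\wp$. At SNR $\rho$ the input covariance must lie in $\mathcal S_\rho=\{\Sigma\succeq 0:\operatorname{Tr}\Sigma\le n\rho\}$, and for every $\rho\ge 1$ and every $\Sigma\in\mathcal S_\rho$ the mean energy (averaged over fading, input and noise) spent by each relay in the $n$ slots must be at most $n\rho$.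 For $r\ge 0$ put $$P_{\rm out}(\wp,r,\rho)=\inf_{\Sigma\in\mathcal S_\rho}\Pr\Big\{\log\frac{\det(K_\wp+H_\wp\Sigma H_\wp^\dagger)}{\det K_\wp}<n\,r\log\rho\Big\},\qquad d(\wp,r)=\liminf_{\rho\to\infty}\frac{-\log P_{\rm out}(\wp,r,\rho)}{\log\rho}.$$ The min-cut of $G$ is the minimum, over node sets $\Omega$ with $s\in\Omega$, $t\notin\Omega$, of the number of edges from $\Omega$ to its complement. A path from $s$ to $t$ has a shortcut if some edge of $G$ leads from a node of the path to a later node of the path that is not its immediate successor. **Theorem.** Let $M$ be the min-cut of $G$, and suppose that either 1. $G$ has no directed cycles, or 2. there are $M$ pairwise edge-disjoint directed paths from $s$ to $t$ none of which has a shortcut. Then the linear DMT $d(r)=M(1-r)^+$ is achievable by AF protocols: for every $\varepsilon>0$ there is an AF protocol $\wp$ with $$d(\wp,r)\ \ge\ M(1-r)^+-\varepsilon\qquad\text{for all } r\ge 0 .$$ -/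

import Mathlib

open MeasureTheory ProbabilityTheory Filter
open scoped ENNReal Matrix ComplexOrder

/-! ### Directed graphs: paths, shortcuts, cuts -/

section Graph

variable {V : Type*}

/-- `p` lists the nodes, in order and without repetition, of a directed path from `s` to `t`. -/
def IsDiPath (G : Digraph V) (s t : V) (p : List V) : Prop :=
  p.IsChain G.Adj ∧ p.Nodup ∧ p.head? = some s ∧ p.getLast? = some t

/-- The directed edges traversed by the path `p`: the pairs of consecutive nodes. -/
def pathEdges (p : List V) : List (V × V) := p.zip p.tail

/-- The path `p` has a shortcut: some edge of `G` leads from a node of `p` to a later node of `p`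
which is not its immediate successor. -/
def HasShortcut (G : Digraph V) (p : List V) : Prop :=
  ∃ i j : Fin p.length, (i : ℕ) + 1 < (j : ℕ) ∧ G.Adj (p.get i) (p.get j)

/-- `G` has no directed cycle. -/
def IsDiAcyclic (G : Digraph V) : Prop := ∀ v, ¬ Relation.TransGen G.Adj v v

/-- The number of edges of `G` crossing from `Ω` to its complement. -/
noncomputable def cutSize (G : Digraph V) (Ω : Set V) : ℕ :=
  {e : V × V | e.1 ∈ Ω ∧ e.2 ∉ Ω ∧ G.Adj e.1 e.2}.ncard

/-- `M` is the value of the min-cut between `s` and `t`. -/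
def IsMinCut (G : Digraph V) (s t : V) (M : ℕ) : Prop :=
  IsLeast {k | ∃ Ω : Set V, s ∈ Ω ∧ t ∉ Ω ∧ cutSize G Ω = k} M

end Graph

/-! ### Fading -/

/-- The circularly symmetric complex Gaussian law `CN(0,1)`: independent real and imaginary parts,
each of mean `0` and variance `1/2`. -/
noncomputable def stdComplexGaussian : Measure ℂ :=
  ((gaussianReal 0 (1 / 2)).prod (gaussianReal 0 (1 / 2))).map (fun z : ℝ × ℝ => (⟨z.1, z.2⟩ : ℂ))

/-- The law of the quasi-static Rayleigh fading coefficients, i.i.d. `CN(0,1)`. The coefficient of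
the edge from `u` to `v` is `h (u, v)`; the values at pairs that are not edges are never used. -/
noncomputable def fadingLaw (V : Type*) [Fintype V] : Measure (V × V → ℂ) :=
  Measure.pi fun _ => stdComplexGaussian

/-! ### Amplify-and-forward protocols -/

/-- An amplify-and-forward protocol for single-antenna nodes `V`: a number of time slots,
a schedule saying in which slots a node transmits and in which it listens, and the scaling constant
with which a node forwards. Nodes are full-duplex: a node may listen and transmit in the same
slot. -/
structure AFProtocol (V : Type*) where
  /-- The number of time slots. -/
  duration : ℕ
  duration_pos : 0 < duration
  /-- The nodes that are scheduled to transmit in a slot. -/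
  transmits : ℕ → Set V
  /-- The nodes that are scheduled to listen in a slot. -/
  listens : ℕ → Set V
  /-- The scaling constants. -/
  gain : V → ℝ
  gain_pos : ∀ v, 0 < gain v

namespace AFProtocol

variable {V : Type*}

open Classical in
/-- The symbol sent by node `v` in slot `τ`, if the contents of the buffers before that slot are
`b` and the source symbols are `x`. The source sends its own symbol, the sink never transmits,
and a relay sends a scaled version of the content of its buffer. -/
noncomputable def send (P : AFProtocol V) (s t : V) (x : ℕ → ℂ) (τ : ℕ) (b : V → ℂ) (v : V) : ℂ :=
  if v ∈ P.transmits τ ∧ v ≠ t then (if v = s then x τ else (P.gain v : ℂ) * b v) else 0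

open Classical in
/-- The symbol received at node `v` in a slot in which the nodes send the symbols `z`
and the noise is `w`: broadcast and interference. -/
noncomputable def receive [Fintype V] (G : Digraph V) (h : V × V → ℂ) (z w : V → ℂ) (v : V) : ℂ :=
  (∑ u, if G.Adj u v then h (u, v) * z u else 0) + w v

open Classical in
/-- The content of the buffer of `v` before slot `τ`: the most recent symbol that `v` received
while listening, and `0` if there is none. Here `x τ` is the source symbol of slot `τ` and
`w τ v` the noise at node `v` in slot `τ`. -/
noncomputable def buffer [Fintype V] (P : AFProtocol V) (G : Digraph V) (s t : V)
    (h : V × V → ℂ) (x : ℕ → ℂ) (w : ℕ → V → ℂ) : ℕ → V → ℂ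
  | 0, _ => 0
  | τ + 1, v =>
    if v ∈ P.listens τ then receive G h (P.send s t x τ (P.buffer G s t h x w τ)) (w τ) v
    else P.buffer G s t h x w τ v

/-- The symbol transmitted by `v` in slot `τ`. -/
noncomputable def transmitted [Fintype V] (P : AFProtocol V) (G : Digraph V) (s t : V)
    (h : V × V → ℂ) (x : ℕ → ℂ) (w : ℕ → V → ℂ) (τ : ℕ) (v : V) : ℂ :=
  P.send s t x τ (P.buffer G s t h x w τ) v

/-- The symbol observed by the sink in slot `τ`. -/
noncomputable def observed [Fintype V] (P : AFProtocol V) (G : Digraph V) (s t : V)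
    (h : V × V → ℂ) (x : ℕ → ℂ) (w : ℕ → V → ℂ) (τ : ℕ) : ℂ :=
  receive G h (P.transmitted G s t h x w τ) (w τ) t

variable [Fintype V] [DecidableEq V] (P : AFProtocol V) (G : Digraph V) (s t : V) (h : V × V → ℂ)

/-- Noise that is `1` at node `e.1` in slot `e.2`, and `0` otherwise. -/
def noiseImpulse (e : V × ℕ) : ℕ → V → ℂ := Pi.single e.2 (Pi.single e.1 1)

/-- The channel matrix induced between the source symbols and the observations of the sink
(responses to unit impulses of the source). -/
noncomputable def channelMatrix : Matrix (Fin P.duration) (Fin P.duration) ℂ :=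
  Matrix.of fun τ σ => P.observed G s t h (Pi.single (σ : ℕ) 1) 0 τ

/-- The matrix through which the noise of all nodes and slots enters the observations
of the sink. -/
noncomputable def noiseMatrix : Matrix (Fin P.duration) (V × Fin P.duration) ℂ :=
  Matrix.of fun τ e => P.observed G s t h 0 (noiseImpulse (e.1, (e.2 : ℕ))) τ

/-- The covariance, given the fading, of the noise seen by the sink; the receiver noises are
i.i.d. `CN(0,1)`. -/
noncomputable def noiseCov : Matrix (Fin P.duration) (Fin P.duration) ℂ :=
  P.noiseMatrix G s t h * (P.noiseMatrix G s t h)ᴴ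

/-- The mutual information between source and sink given the fading, `log det (K + H Σ Hᴴ) -
log det K`, for a Gaussian input with covariance `S`, where `H` is the induced channel matrix and
`K` the covariance of the (coloured) noise. -/
noncomputable def mutualInfo (S : Matrix (Fin P.duration) (Fin P.duration) ℂ) : ℝ :=
  Real.log (P.noiseCov G s t h + P.channelMatrix G s t h * S * (P.channelMatrix G s t h)ᴴ).det.re
    - Real.log (P.noiseCov G s t h).det.re

/-- The input covariances allowed at signal-to-noise ratio `ρ`: positive semidefinite, with trace
at most `n ρ`, where `n` is the number of slots. -/
def inputCovs (ρ : ℝ) : Set (Matrix (Fin P.duration) (Fin P.duration) ℂ) :=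
  {S | S.PosSemidef ∧ S.trace.re ≤ P.duration * ρ}

/-- The outage probability at multiplexing gain `r`, i.e. at rate `r log ρ` per slot. -/
noncomputable def outageProb (r ρ : ℝ) : ℝ≥0∞ :=
  ⨅ S ∈ P.inputCovs ρ,
    fadingLaw V {h | P.mutualInfo G s t h S < P.duration * (r * Real.log ρ)}

/-- The outage exponent (the DMT) of the protocol at multiplexing gain `r`. -/
noncomputable def outageExponent (r : ℝ) : EReal :=
  liminf (fun ρ : ℝ => -(ENNReal.log (P.outageProb G s t r ρ)) / ((Real.log ρ : ℝ) : EReal)) atTop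

/-- How the source symbols enter the symbols transmitted by `v`. -/
noncomputable def relaySignalMatrix (v : V) : Matrix (Fin P.duration) (Fin P.duration) ℂ :=
  Matrix.of fun τ σ => P.transmitted G s t h (Pi.single (σ : ℕ) 1) 0 τ v

/-- How the noise enters the symbols transmitted by `v`. -/
noncomputable def relayNoiseMatrix (v : V) : Matrix (Fin P.duration) (V × Fin P.duration) ℂ :=
  Matrix.of fun τ e => P.transmitted G s t h 0 (noiseImpulse (e.1, (e.2 : ℕ))) τ v

/-- The energy, given the fading, that node `v` spends in all slots together when the input
covariance is `S`. -/
noncomputable def relayEnergy (v : V) (S : Matrix (Fin P.duration) (Fin P.duration) ℂ) : ℝ :=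
  (P.relaySignalMatrix G s t h v * S * (P.relaySignalMatrix G s t h v)ᴴ
    + P.relayNoiseMatrix G s t h v * (P.relayNoiseMatrix G s t h v)ᴴ).trace.re

/-- The energy constraint at the relays, the same as at the source: for every `ρ ≥ 1` and every
allowed input covariance, the mean energy spent by a relay is at most `n ρ`. -/
def MeetsEnergyConstraint : Prop :=
  ∀ ρ : ℝ, 1 ≤ ρ → ∀ S ∈ P.inputCovs ρ, ∀ v, v ≠ s → v ≠ t →
    ∫⁻ h, ENNReal.ofReal (P.relayEnergy G s t h v S) ∂(fadingLaw V)
      ≤ ENNReal.ofReal (P.duration * ρ)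

end AFProtocol

/-- The DMT `d` is achievable by amplify-and-forward protocols in the single-antenna
full-duplex network `G` with source `s` and sink `t`: up to an arbitrarily small loss, uniform in
the multiplexing gain, it is attained by an AF protocol obeying the energy constraint. -/
def IsAchievableByAF {V : Type*} [Fintype V] [DecidableEq V] (G : Digraph V) (s t : V)
    (d : ℝ → ℝ) : Prop :=
  ∀ ε : ℝ, 0 < ε → ∃ P : AFProtocol V, P.MeetsEnergyConstraint G s t ∧
    ∀ r : ℝ, 0 ≤ r → ((d r - ε : ℝ) : EReal) ≤ P.outageExponent G s t r

/-! Take `M` edge-disjoint paths (from Menger's theorem in the acyclic case) and activate them one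
after the other, each for `T + |V|` slots, with a fixed small gain `a`. A source symbol crosses an
active path of `L` edges with coefficient `a ^ (L - 1)` times the product of the fading on these
edges. Other edges between nodes of the path only disturb one side of the diagonal: in an acyclic
graph they make symbols arrive early, and without shortcuts they make them arrive late. Signals left
over from earlier paths only enter later blocks. So a minor of size `M * T` is triangular, with
determinant `g ^ T`, where `g` is the product of the path coefficients (`exists_minor`).

The noise of the sink itself is white and fills up the remaining rows, so white input of power `ρ`
gives `det (K + ρ H Hᴴ) ≥ ρ ^ (M T) |g| ^ (2 T)` (`pow_mul_norm_sq_det_le`). Outage therefore forces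
`ρ ^ (c (M - n r / T)) ≤ (det K) ^ (c / T) |g| ^ (-2 c)`. By Markov's inequality the outage
probability is `O(ρ ^ (-c (M - n r / T)))` once the right-hand side has finite mean
(`exists_outageProb_le`). It does for `c < 1`: `det K` grows polynomially in the fading, negative
moments of `|h|` of order below `2` are finite, and edge-disjointness makes each `|h e|` occur at
most once in `|g|`. Since `n = M (T + |V|) + 1`, letting `c → 1` and `T → ∞` gives `M (1 - r)`,
uniformly for `r` in `[0, 1]`. -/

/-! ### Integer flows and edge-disjoint paths -/

section Flow

variable {V : Type*}

/-- Reachability is witnessed by a chain without repetitions. -/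
lemma exists_nodup_isChain {r : V → V → Prop} {a b : V} (h : Relation.ReflTransGen r a b) :
    ∃ l : List V, (a :: l).IsChain r ∧ (a :: l).Nodup ∧ (a :: l).getLast? = some b := by
  induction h using Relation.ReflTransGen.head_induction_on with
  | refl => exact ⟨[], by simp⟩
  | @head a c hac _ ih =>
    obtain ⟨l, hl, hn, hb⟩ := ih
    by_cases hmem : a ∈ c :: l
    · obtain ⟨l₁, l₂, he⟩ := List.append_of_mem hmem
      rw [he] at hl hn hb
      refine ⟨l₂, hl.right_of_append, hn.of_append_right, ?_⟩
      rw [List.getLast?_append] at hb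
      simpa [List.getLast?_cons] using hb
    · exact ⟨c :: l, by simpa using ⟨hac, hl⟩, List.nodup_cons.2 ⟨hmem, hn⟩, by
        rw [List.getLast?_cons_cons]; exact hb⟩

lemma pathEdges_cons_cons (a b : V) (l : List V) :
    pathEdges (a :: b :: l) = (a, b) :: pathEdges (b :: l) := rfl

lemma rel_of_mem_pathEdges {r : V → V → Prop} {p : List V} (hp : p.IsChain r) {e : V × V}
    (he : e ∈ pathEdges p) : r e.1 e.2 := by
  induction p with
  | nil => simp [pathEdges] at he
  | cons a l ih =>
    cases l with
    | nil => simp [pathEdges] at he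
    | cons b l =>
      rw [pathEdges_cons_cons, List.mem_cons] at he
      rw [List.isChain_cons_cons] at hp
      rcases he with rfl | he
      · exact hp.1
      · exact ih hp.2 he

/-- The sum of the contributions `g v w` of the steps `v, w` of the list `p`. -/
def pathSum (g : V → V → V → V → ℤ) (p : List V) (x y : V) : ℤ :=
  ((pathEdges p).map fun e => g e.1 e.2 x y).sum

lemma pathSum_cons_cons (g : V → V → V → V → ℤ) (a b : V) (l : List V) (x y : V) :
    pathSum g (a :: b :: l) x y = g a b x y + pathSum g (b :: l) x y := by
  simp [pathSum, pathEdges_cons_cons]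

lemma mem_of_pathSum_ne_zero {g : V → V → V → V → ℤ}
    (hg : ∀ v w x y, g v w x y ≠ 0 → (x = v ∧ y = w) ∨ (x = w ∧ y = v)) {p : List V} {x y : V}
    (h : pathSum g p x y ≠ 0) : x ∈ p ∧ y ∈ p := by
  induction p with
  | nil => simp [pathSum, pathEdges] at h
  | cons a l ih =>
    cases l with
    | nil => simp [pathSum, pathEdges] at h
    | cons b l =>
      rw [pathSum_cons_cons] at h
      by_cases h0 : g a b x y = 0
      · obtain ⟨h1, h2⟩ := ih (by simpa [h0] using h)
        exact ⟨List.mem_cons_of_mem _ h1, List.mem_cons_of_mem _ h2⟩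
      · rcases hg _ _ _ _ h0 with ⟨rfl, rfl⟩ | ⟨rfl, rfl⟩ <;> simp

/-- Along a list without repetitions at most one step contributes to a given pair of nodes. -/
lemma pathSum_eq_zero_or {g : V → V → V → V → ℤ}
    (hg : ∀ v w x y, g v w x y ≠ 0 → (x = v ∧ y = w) ∨ (x = w ∧ y = v)) {p : List V}
    (hp : p.Nodup) (x y : V) :
    pathSum g p x y = 0 ∨ ∃ e ∈ pathEdges p, pathSum g p x y = g e.1 e.2 x y := by
  induction p with
  | nil => simp [pathSum, pathEdges]
  | cons a l ih =>
    cases l with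
    | nil => simp [pathSum, pathEdges]
    | cons b l =>
      rw [pathSum_cons_cons]
      by_cases h0 : g a b x y = 0
      · rcases ih hp.of_cons with h | ⟨e, he, h⟩
        · exact Or.inl (by simp [h0, h])
        · exact Or.inr ⟨e, List.mem_cons_of_mem _ he, by simp [h0, h]⟩
      · refine Or.inr ⟨(a, b), by simp [pathEdges_cons_cons], ?_⟩
        by_contra hne
        have hne' : pathSum g (b :: l) x y ≠ 0 := fun h => hne (by simp [h])
        have hmem := mem_of_pathSum_ne_zero hg hne'
        have ha := (List.nodup_cons.1 hp).1
        rcases hg _ _ _ _ h0 with ⟨rfl, rfl⟩ | ⟨rfl, rfl⟩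
        · exact ha hmem.1
        · exact ha hmem.2

variable [Fintype V]

/-- The net amount that the flow `f` sends out of `v`. -/
def netOut (f : V → V → ℤ) (v : V) : ℤ := ∑ w, (f v w - f w v)

variable [DecidableEq V]

/-- The summand is antisymmetric, so pairs inside `Ω` cancel; the value of a flow can thus be read
off at any cut. -/
lemma sum_netOut (f : V → V → ℤ) (Ω : Finset V) :
    ∑ v ∈ Ω, netOut f v = ∑ v ∈ Ω, ∑ w ∈ Ωᶜ, (f v w - f w v) := by
  have h0 : ∑ v ∈ Ω, ∑ w ∈ Ω, (f v w - f w v) = 0 := by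
    simp only [Finset.sum_sub_distrib]
    rw [Finset.sum_comm, sub_self]
  simp only [netOut]
  simp_rw [← Finset.sum_add_sum_compl Ω]
  rw [Finset.sum_add_distrib, h0, zero_add]

/-- The contributions of single steps telescope. A general `g` covers both steps that add flow and
steps that cancel flow on a reversed edge. -/
lemma netOut_pathSum {g : V → V → V → V → ℤ}
    (hg : ∀ v w x, netOut (g v w) x = (if x = v then 1 else 0) - (if x = w then 1 else 0))
    (a : V) (l : List V) (b : V) (hb : (a :: l).getLast? = some b) (x : V) :
    netOut (pathSum g (a :: l)) x = (if x = a then 1 else 0) - (if x = b then 1 else 0) := by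
  induction l generalizing a with
  | nil =>
    obtain rfl : a = b := by simpa using hb
    simp [netOut, pathSum, pathEdges]
  | cons c l ih =>
    rw [List.getLast?_cons_cons] at hb
    have h1 := ih c hb
    have h2 := hg a c x
    have h3 : netOut (pathSum g (a :: c :: l)) x
        = netOut (g a c) x + netOut (pathSum g (c :: l)) x := by
      simp only [netOut, pathSum_cons_cons, ← Finset.sum_add_distrib]
      exact Finset.sum_congr rfl fun _ _ => by ring
    rw [h3, h1, h2]
    ring

lemma netOut_single (v w x : V) :
    netOut (fun y z => if y = v ∧ z = w then 1 else 0) x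
      = (if x = v then 1 else 0) - (if x = w then 1 else 0) := by
  simp only [netOut, Finset.sum_sub_distrib, ite_and]
  by_cases h1 : x = v <;> by_cases h2 : x = w <;> simp [h1, h2]

/-- A `0`-`1` flow on the edges of `G`, of value `k`, from `s` to `t`. -/
def IsUnitFlow (G : Digraph V) (s t : V) (k : ℕ) (f : V → V → ℤ) : Prop :=
  (∀ x y, f x y = 0 ∨ (f x y = 1 ∧ G.Adj x y)) ∧
    ∀ v, netOut f v = k * ((if v = s then 1 else 0) - (if v = t then 1 else 0))

lemma IsUnitFlow.sum_netOut {G : Digraph V} {s t : V} {k : ℕ} {f : V → V → ℤ}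
    (hf : IsUnitFlow G s t k f) {Ω : Finset V} (hs : s ∈ Ω) (ht : t ∉ Ω) :
    ∑ v ∈ Ω, netOut f v = k := by
  simp [hf.2, ← Finset.mul_sum, hs, ht]

/-- Augmentation of flows. -/
lemma exists_isUnitFlow (G : Digraph V) (s t : V) (k : ℕ)
    (hcut : ∀ Ω : Set V, s ∈ Ω → t ∉ Ω → k ≤ cutSize G Ω) :
    ∃ f, IsUnitFlow G s t k f := by
  classical
  induction k with
  | zero => exact ⟨fun _ _ => 0, by simp [IsUnitFlow, netOut]⟩
  | succ k ih =>
    obtain ⟨f, hf⟩ := ih fun Ω h1 h2 => (Nat.le_succ k).trans (hcut Ω h1 h2)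
    -- Residual graph: a step either undoes flow on the reversed edge or uses an empty edge.
    let r : V → V → Prop := fun v w => f w v = 1 ∨ (G.Adj v w ∧ f v w = 0)
    by_cases hr : Relation.ReflTransGen r s t
    · obtain ⟨l, hl, hn, hlast⟩ := exists_nodup_isChain hr
      let g : V → V → V → V → ℤ := fun v w x y =>
        if f w v = 1 then -(if x = w ∧ y = v then 1 else 0) else if x = v ∧ y = w then 1 else 0
      have hsupp : ∀ v w x y, g v w x y ≠ 0 → (x = v ∧ y = w) ∨ (x = w ∧ y = v) := by
        intro v w x y h
        by_contra hc
        push Not at hc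
        apply h
        simp only [g]
        split_ifs <;> simp_all
      have hnet : ∀ v w x, netOut (g v w) x
          = (if x = v then 1 else 0) - (if x = w then 1 else 0) := by
        intro v w x
        by_cases h : f w v = 1
        · have : netOut (g v w) x = -netOut (fun y z => if y = w ∧ z = v then 1 else 0) x := by
            simp only [g, h, netOut, ← Finset.sum_neg_distrib]
            exact Finset.sum_congr rfl fun _ _ => by simp; ring
          rw [this, netOut_single]
          ring
        · have : g v w = fun y z => if y = v ∧ z = w then 1 else 0 := by
            funext y z; simp [g, h]
          rw [this, netOut_single]
      refine ⟨fun x y => f x y + pathSum g (s :: l) x y, fun x y => ?_, fun v => ?_⟩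
      · rcases pathSum_eq_zero_or hsupp hn x y with h | ⟨e, he, h⟩
        · simpa [h] using hf.1 x y
        · beta_reduce
          rw [h]
          have hre : r e.1 e.2 := rel_of_mem_pathEdges hl he
          simp only [g]
          split_ifs with h1 h2 h3
          · rw [h2.1, h2.2]; simp [h1]
          · simpa using hf.1 x y
          · rcases hre with h4 | ⟨h4, h5⟩
            · exact absurd h4 h1
            · rw [h3.1, h3.2]; simp [h4, h5]
          · simpa using hf.1 x y
      · have h3 : netOut (fun x y => f x y + pathSum g (s :: l) x y) v
            = netOut f v + netOut (pathSum g (s :: l)) v := by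
          simp only [netOut, ← Finset.sum_add_distrib]
          exact Finset.sum_congr rfl fun _ _ => by ring
        rw [h3, hf.2, netOut_pathSum hnet s l t hlast]
        push_cast
        ring
    · exfalso
      -- All edges leaving the residually reachable set are saturated and all edges entering it are
      -- empty, so this cut has size `k`, contradicting `hcut`.
      let Ω : Finset V := Finset.univ.filter fun v => Relation.ReflTransGen r s v
      have hsΩ : s ∈ Ω := by simp [Ω, Relation.ReflTransGen.refl]
      have htΩ : t ∉ Ω := by simpa [Ω] using hr
      have h1 := hf.sum_netOut hsΩ htΩ
      have hcl : ∀ v ∈ Ω, ∀ w ∈ Ωᶜ, ¬ r v w := by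
        intro v hv w hw hvw
        simp only [Ω, Finset.mem_compl, Finset.mem_filter, Finset.mem_univ, true_and] at hv hw
        exact hw (hv.tail hvw)
      have h2 : ∑ v ∈ Ω, ∑ w ∈ Ωᶜ, (f v w - f w v)
          = ∑ v ∈ Ω, ∑ w ∈ Ωᶜ, (if G.Adj v w then 1 else 0) := by
        refine Finset.sum_congr rfl fun v hv => Finset.sum_congr rfl fun w hw => ?_
        have h := hcl v hv w hw
        simp only [r, not_or, not_and] at h
        have h3 : f w v = 0 := (hf.1 w v).resolve_right fun h' => h.1 h'.1
        rcases hf.1 v w with h4 | h4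
        · have : ¬ G.Adj v w := fun h' => h.2 h' h4
          simp [h3, h4, this]
        · simp [h3, h4]
      have h3 : (cutSize G (Ω : Set V) : ℤ)
          = ∑ v ∈ Ω, ∑ w ∈ Ωᶜ, (if G.Adj v w then 1 else 0) := by
        have h4 : {e : V × V | e.1 ∈ (Ω : Set V) ∧ e.2 ∉ (Ω : Set V) ∧ G.Adj e.1 e.2}
            = (((Ω ×ˢ Ωᶜ).filter fun e => G.Adj e.1 e.2 : Finset (V × V)) : Set (V × V)) := by
          ext e
          simp [and_assoc]
        rw [cutSize, h4, Set.ncard_coe_finset, ← Finset.sum_product', Finset.card_filter]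
        push_cast
        rfl
      have h4 := hcut Ω (by simpa using hsΩ) (by simpa using htΩ)
      rw [_root_.sum_netOut, h2, ← h3] at h1
      have : cutSize G (Ω : Set V) = k := by exact_mod_cast h1
      omega

/-- Decomposition of a `0`-`1` flow into edge-disjoint paths. -/
lemma IsUnitFlow.exists_paths {G : Digraph V} {s t : V} {k : ℕ} {f : V → V → ℤ}
    (hf : IsUnitFlow G s t k f) :
    ∃ p : Fin k → List V, (∀ i, IsDiPath G s t (p i)) ∧
      (∀ i, ∀ e ∈ pathEdges (p i), f e.1 e.2 = 1) ∧
      ∀ i j, i ≠ j → List.Disjoint (pathEdges (p i)) (pathEdges (p j)) := by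
  classical
  induction k generalizing f with
  | zero => exact ⟨fun i => i.elim0, fun i => i.elim0, fun i => i.elim0, fun i => i.elim0⟩
  | succ k ih =>
    let r : V → V → Prop := fun v w => f v w = 1
    -- Otherwise no flow would leave the set reachable along flow-carrying edges, although its net
    -- outflow is `k + 1`.
    have hr : Relation.ReflTransGen r s t := by
      by_contra hr
      let Ω : Finset V := Finset.univ.filter fun v => Relation.ReflTransGen r s v
      have hsΩ : s ∈ Ω := by simp [Ω, Relation.ReflTransGen.refl]
      have htΩ : t ∉ Ω := by simpa [Ω] using hr
      have h1 := hf.sum_netOut hsΩ htΩ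
      rw [_root_.sum_netOut] at h1
      have h2 : ∑ v ∈ Ω, ∑ w ∈ Ωᶜ, (f v w - f w v) ≤ 0 := by
        refine Finset.sum_nonpos fun v hv => Finset.sum_nonpos fun w hw => ?_
        simp only [Ω, Finset.mem_compl, Finset.mem_filter, Finset.mem_univ, true_and] at hv hw
        have h3 : f v w = 0 := (hf.1 v w).resolve_right fun h' => hw (hv.tail h'.1)
        rcases hf.1 w v with h4 | h4 <;> omega
      push_cast at h1
      omega
    obtain ⟨l, hl, hn, hlast⟩ := exists_nodup_isChain hr
    let g : V → V → V → V → ℤ := fun v w x y => if x = v ∧ y = w then 1 else 0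
    have hsupp : ∀ v w x y, g v w x y ≠ 0 → (x = v ∧ y = w) ∨ (x = w ∧ y = v) := by
      intro v w x y h
      simp only [g, ne_eq, ite_eq_right_iff, one_ne_zero, imp_false, not_not] at h
      exact Or.inl h
    have hval : ∀ x y, (pathSum g (s :: l) x y = 0 ∧ (x, y) ∉ pathEdges (s :: l)) ∨
        (pathSum g (s :: l) x y = 1 ∧ (x, y) ∈ pathEdges (s :: l)) := by
      intro x y
      by_cases hm : (x, y) ∈ pathEdges (s :: l)
      · refine Or.inr ⟨?_, hm⟩
        have h1 : 1 ≤ pathSum g (s :: l) x y := by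
          refine List.single_le_sum (fun z hz => ?_) _ (List.mem_map.2 ⟨(x, y), hm, by simp [g]⟩)
          obtain ⟨e, -, rfl⟩ := List.mem_map.1 hz
          simp only [g]
          split_ifs <;> simp
        rcases pathSum_eq_zero_or hsupp hn x y with h | ⟨e, -, h⟩
        · omega
        · have : g e.1 e.2 x y ≤ 1 := by simp only [g]; split_ifs <;> simp
          omega
      · refine Or.inl ⟨?_, hm⟩
        rcases pathSum_eq_zero_or hsupp hn x y with h | ⟨e, he, h⟩
        · exact h
        · rw [h]
          simp only [g, ite_eq_right_iff, one_ne_zero, imp_false]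
          rintro ⟨rfl, rfl⟩
          exact hm he
    have hfe : ∀ e ∈ pathEdges (s :: l), f e.1 e.2 = 1 := fun e he => rel_of_mem_pathEdges hl he
    have hf' : IsUnitFlow G s t k fun x y => f x y - pathSum g (s :: l) x y := by
      refine ⟨fun x y => ?_, fun v => ?_⟩
      · rcases hval x y with ⟨h, -⟩ | ⟨h, hm⟩
        · simpa [h] using hf.1 x y
        · have := hfe _ hm
          simp only at this
          simp [h, this]
      · have h3 : netOut (fun x y => f x y - pathSum g (s :: l) x y) v
            = netOut f v - netOut (pathSum g (s :: l)) v := by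
          simp only [netOut, ← Finset.sum_sub_distrib]
          exact Finset.sum_congr rfl fun _ _ => by ring
        rw [h3, hf.2, netOut_pathSum (fun v w x => netOut_single v w x) s l t hlast]
        push_cast
        ring
    obtain ⟨p, hp1, hp2, hp3⟩ := ih hf'
    -- The other paths use edges on which the reduced flow is `1`; on the removed path it is `0`.
    have hdis : ∀ i, List.Disjoint (pathEdges (s :: l)) (pathEdges (p i)) := by
      intro i e he he'
      have h1 := hp2 i e he'
      have h2 := hfe e he
      rcases hval e.1 e.2 with ⟨-, h⟩ | ⟨h, -⟩
      · exact h he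
      · omega
    refine ⟨Fin.cons (s :: l) p, fun i => ?_, fun i => ?_, fun i j => ?_⟩
    · refine Fin.cases ?_ (fun i => ?_) i
      · refine ⟨hl.imp fun x y (h : f x y = 1) => ?_, hn, rfl, hlast⟩
        rcases hf.1 x y with h' | h'
        · omega
        · exact h'.2
      · simpa using hp1 i
    · refine Fin.cases (by simpa using hfe) (fun i => ?_) i
      intro e he
      have h1 := hp2 i e (by simpa using he)
      rcases hval e.1 e.2 with ⟨h, -⟩ | ⟨-, h⟩
      · omega
      · exact hfe e h
    · refine Fin.cases ?_ (fun i => ?_) i <;> refine Fin.cases ?_ (fun j => ?_) j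
      · simp
      · intro _; simpa using hdis j
      · intro _; simpa using (hdis i).symm
      · intro hij
        simpa using hp3 i j fun h => hij (by rw [h])

/-- The edge version of Menger's theorem for directed graphs. -/
theorem exists_edgeDisjoint_paths {G : Digraph V} {s t : V} {M : ℕ} (hM : IsMinCut G s t M) :
    ∃ p : Fin M → List V, (∀ i, IsDiPath G s t (p i)) ∧
      ∀ i j, i ≠ j → List.Disjoint (pathEdges (p i)) (pathEdges (p j)) := by
  obtain ⟨f, hf⟩ := exists_isUnitFlow G s t M fun Ω h1 h2 => hM.2 ⟨Ω, h1, h2, rfl⟩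
  obtain ⟨p, h1, -, h2⟩ := hf.exists_paths
  exact ⟨p, h1, h2⟩

end Flow

/-! ### Determinants -/

section Determinants

variable {n m ι : Type*} [Fintype n] [Fintype m] [Fintype ι]

lemma one_le_det_one_add [DecidableEq n] {X : Matrix n n ℂ} (hX : X.PosSemidef) : 1 ≤ (1 + X).det := by
  have hH := hX.isHermitian
  have h1 : (1 + X).det = ∏ i, (1 + (hH.eigenvalues i : ℂ)) := by
    -- Up to sign, `det (1 + X)` is the characteristic polynomial of `X` at `-1`.
    have h2 : 1 + X = -(Matrix.scalar n (-1 : ℂ) - X) := by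
      rw [map_neg, map_one, neg_sub, sub_neg_eq_add, add_comm]
    rw [h2, Matrix.det_neg, ← Matrix.eval_charpoly, hH.charpoly_eq, Polynomial.eval_prod,
      ← Finset.card_univ, ← Finset.prod_const, ← Finset.prod_mul_distrib]
    refine Finset.prod_congr rfl fun i _ => ?_
    simp
    ring
  have h3 : (1 + X).det = ((∏ i, (1 + hH.eigenvalues i) : ℝ) : ℂ) := by
    rw [h1]
    push_cast
    rfl
  rw [h3]
  have h4 : (1 : ℝ) ≤ ∏ i, (1 + hH.eigenvalues i) :=
    Finset.one_le_prod fun i => by simpa using hX.eigenvalues_nonneg i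
  exact_mod_cast h4

/-- A weak form of the Cauchy-Binet formula: the Gram determinant dominates each maximal minor. -/
lemma norm_sq_det_submatrix_le [DecidableEq n] (F : Matrix n m ℂ) (c : n → m) (hc : Function.Injective c) :
    ‖(F.submatrix id c).det‖ ^ 2 ≤ (F * Fᴴ).det.re := by
  classical
  set A := F.submatrix id c with hA
  let d : {x : m // x ∉ Set.range c} → m := Subtype.val
  set B := F.submatrix id d with hB
  have hsum : F * Fᴴ = A * Aᴴ + B * Bᴴ := by
    ext i j
    simp only [Matrix.mul_apply, Matrix.add_apply, Matrix.conjTranspose_apply, hA, hB,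
      Matrix.submatrix_apply, id]
    rw [← Fintype.sum_subtype_add_sum_subtype (· ∈ Set.range c)
      fun k => F i k * star (F j k)]
    congr 1
    convert (Fintype.sum_equiv (Equiv.ofInjective c hc) _
      (fun k : {k // k ∈ Set.range c} => F i k.1 * star (F j k.1)) fun _ => rfl).symm <;> rfl
  by_cases h0 : A.det = 0
  · have : 0 ≤ (F * Fᴴ).det := (Matrix.posSemidef_self_mul_conjTranspose F).det_nonneg
    rw [h0]
    simpa using (Complex.le_def.1 this).1
  -- An invertible `A` can be factored out on both sides, leaving `1 + C * Cᴴ` of determinant at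
  -- least `1`.
  · have hu : IsUnit A.det := isUnit_iff_ne_zero.2 h0
    set C := A⁻¹ * B
    have hB' : B = A * C := by rw [Matrix.mul_nonsing_inv_cancel_left _ _ hu]
    have hfac : F * Fᴴ = A * (1 + C * Cᴴ) * Aᴴ := by
      rw [hsum, hB', Matrix.conjTranspose_mul]
      simp only [Matrix.mul_add, Matrix.add_mul, Matrix.mul_one, Matrix.mul_assoc]
    have h1 := one_le_det_one_add (Matrix.posSemidef_self_mul_conjTranspose C)
    have h2 : (F * Fᴴ).det = ((‖A.det‖ ^ 2 : ℝ) : ℂ) * (1 + C * Cᴴ).det := by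
      rw [hfac, Matrix.det_mul, Matrix.det_mul, Matrix.det_conjTranspose, mul_right_comm]
      congr 1
      simpa using Complex.mul_conj' A.det
    rw [h2, Complex.re_ofReal_mul]
    exact le_mul_of_one_le_right (by positivity) (Complex.le_def.1 h1).1

/-- If the noise `N` has a component that is white, then a minor of the channel matrix `H` bounds
the determinant of the covariance of the output from below. -/
lemma pow_mul_norm_sq_det_le [DecidableEq n] [DecidableEq ι] (N : Matrix n m ℂ) (H : Matrix n n ℂ) (w : n → m)
    (hw : ∀ i j, N i (w j) = if i = j then 1 else 0) (R C : ι → n)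
    (hR : Function.Injective R) (hC : Function.Injective C) {ρ : ℝ} (hρ : 0 ≤ ρ) :
    ρ ^ Fintype.card ι * ‖(H.submatrix R C).det‖ ^ 2
      ≤ (N * Nᴴ + H * ((ρ : ℂ) • (1 : Matrix n n ℂ)) * Hᴴ).det.re := by
  classical
  let e : ι ⊕ {x : n // x ∉ Set.range R} ≃ n :=
    (Equiv.sumCongr (Equiv.ofInjective R hR) (Equiv.refl _)).trans
      (Equiv.sumCompl (· ∈ Set.range R))
  have e1 : ∀ i, e (Sum.inl i) = R i := fun i => rfl
  have e2 : ∀ i, e (Sum.inr i) = i.1 := fun i => rfl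
  -- `F * Fᴴ` is the output covariance. The chosen columns are signal columns for the rows in `R`
  -- and white-noise columns for all other rows; this minor is block triangular with an identity
  -- block.
  let F : Matrix n (m ⊕ n) ℂ := Matrix.fromCols N ((√ρ : ℂ) • H)
  let c : ι ⊕ {x : n // x ∉ Set.range R} → m ⊕ n :=
    Sum.elim (fun i => Sum.inr (C i)) (fun i => Sum.inl (w i.1))
  have hwinj : Function.Injective w := by
    intro i j hij
    by_contra hne
    have h1 := hw i j
    rw [← hij, hw i i] at h1
    simp [hne] at h1
  have hc : Function.Injective c := by
    rintro (i | i) (j | j) h <;> simp only [c, Sum.elim_inl, Sum.elim_inr, reduceCtorEq,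
      Sum.inr.injEq, Sum.inl.injEq] at h
    · rw [hC h]
    · rw [Subtype.ext (hwinj h)]
  have hF : F * Fᴴ = N * Nᴴ + H * ((ρ : ℂ) • (1 : Matrix n n ℂ)) * Hᴴ := by
    simp only [F, Matrix.conjTranspose_fromCols_eq_fromRows_conjTranspose,
      Matrix.fromCols_mul_fromRows]
    congr 1
    rw [Matrix.conjTranspose_smul, Matrix.smul_mul, Matrix.mul_smul, smul_smul, Matrix.mul_smul,
      Matrix.mul_one, Matrix.smul_mul]
    congr 1
    have : (√ρ : ℂ) * √ρ = ρ := by rw [← Complex.ofReal_mul, Real.mul_self_sqrt hρ]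
    simpa using this
  have h1 := norm_sq_det_submatrix_le (F.submatrix e id) c hc
  have h2 : (F.submatrix e id * (F.submatrix e id)ᴴ).det = (F * Fᴴ).det := by
    rw [← Matrix.det_submatrix_equiv_self e (F * Fᴴ)]
    rfl
  have h3 : ((F.submatrix e id).submatrix id c) = Matrix.fromBlocks
      ((√ρ : ℂ) • H.submatrix R C) 0
      ((√ρ : ℂ) • H.submatrix (fun i : {x : n // x ∉ Set.range R} => i.1) C) 1 := by
    ext i j
    rcases i with i | i <;> rcases j with j | j
    · simp [F, c, e1]
    · have : R i ≠ j.1 := fun h => j.2 ⟨i, h⟩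
      simp [F, c, e1, hw, this]
    · simp [F, c, e2]
    · simp [F, c, e2, hw, Matrix.one_apply, Subtype.ext_iff]
  rw [h2, hF, h3, Matrix.det_fromBlocks_zero₁₂, Matrix.det_one, mul_one, Matrix.det_smul,
    norm_mul, norm_pow, mul_pow, Complex.norm_real, Real.norm_of_nonneg (Real.sqrt_nonneg _),
    ← pow_mul, mul_comm _ 2, pow_mul, Real.sq_sqrt hρ] at h1
  exact h1

lemma one_le_det_mul_conjTranspose [DecidableEq n] (N : Matrix n m ℂ) (w : n → m)
    (hw : ∀ i j, N i (w j) = if i = j then 1 else 0) : 1 ≤ (N * Nᴴ).det.re := by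
  have h := pow_mul_norm_sq_det_le N 0 w hw (Fin.elim0 : Fin 0 → n) Fin.elim0
    (fun i => i.elim0) (fun i => i.elim0) zero_le_one
  simpa using h

/-- The determinant of a matrix that is triangular for some ordering of the indices. -/
lemma det_eq_prod_diag [DecidableEq ι] {X : Matrix ι ι ℂ} (b : ι → ℕ) (hb : Function.Injective b)
    (h : ∀ i j, b i < b j → X i j = 0) : X.det = ∏ i, X i i := by
  let _ : LinearOrder ι := LinearOrder.lift' b hb
  have h1 : X.BlockTriangular OrderDual.toDual := fun i j hij => h i j hij
  convert Matrix.det_of_isLowerTriangular X h1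

/-- Crude Leibniz bound. Polynomial growth of `det K` suffices because all positive moments of the
fading are finite. -/
lemma re_det_mul_conjTranspose_le [DecidableEq n] (N : Matrix n m ℂ) {x : ℝ} (hx : ∀ i j, ‖N i j‖ ≤ x) :
    (N * Nᴴ).det.re ≤ (Fintype.card n).factorial * (Fintype.card m * x ^ 2) ^ Fintype.card n := by
  have h := Matrix.det_le (A := N * Nᴴ) (abv := IsAbsoluteValue.toAbsoluteValue (norm : ℂ → ℝ))
    (x := Fintype.card m * x ^ 2) fun i j => by
      simp only [IsAbsoluteValue.toAbsoluteValue_apply, Matrix.mul_apply,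
        Matrix.conjTranspose_apply]
      refine (norm_sum_le _ _).trans ?_
      rw [← nsmul_eq_mul, ← Finset.card_univ, ← Finset.sum_const]
      refine Finset.sum_le_sum fun k _ => ?_
      rw [norm_mul, norm_star, sq]
      exact mul_le_mul (hx _ _) (hx _ _) (norm_nonneg _) ((norm_nonneg _).trans (hx i k))
  refine (Complex.re_le_norm _).trans (h.trans_eq ?_)
  simp

-- Write `S = Bᴴ * B`: in each row of `B`, a product of two entries is at most the sum of the
-- squares of that row, and these sums add up to the trace.
open scoped MatrixOrder in
lemma norm_apply_le_trace_of_posSemidef {S : Matrix n n ℂ} (hS : S.PosSemidef) (i j : n) :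
    ‖S i j‖ ≤ S.trace.re := by
  classical
  obtain ⟨B, rfl⟩ := CStarAlgebra.nonneg_iff_eq_star_mul_self.mp hS.nonneg
  rw [Matrix.star_eq_conjTranspose]
  have htr : (Bᴴ * B).trace.re = ∑ k, ∑ l, ‖B k l‖ ^ 2 := by
    rw [Finset.sum_comm, Matrix.trace, Complex.re_sum]
    refine Finset.sum_congr rfl fun l _ => ?_
    simp only [Matrix.diag_apply, Matrix.mul_apply, Matrix.conjTranspose_apply, Complex.re_sum]
    refine Finset.sum_congr rfl fun k _ => ?_
    have := Complex.conj_mul' (B k l)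
    rw [starRingEnd_apply] at this
    rw [this]
    exact_mod_cast Complex.ofReal_re _
  rw [htr, Matrix.mul_apply]
  refine (norm_sum_le _ _).trans (Finset.sum_le_sum fun k _ => ?_)
  have h : ∀ l, ‖B k l‖ ^ 2 ≤ ∑ l, ‖B k l‖ ^ 2 := fun l =>
    Finset.single_le_sum (f := fun l => ‖B k l‖ ^ 2) (fun _ _ => by positivity)
      (Finset.mem_univ l)
  rw [Matrix.conjTranspose_apply, norm_mul, norm_star]
  nlinarith [h i, h j, sq_nonneg (‖B k i‖ - ‖B k j‖)]

/-- A crude bound on the trace of a transformed covariance. -/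
lemma re_trace_mul_mul_conjTranspose_le (A : Matrix m n ℂ) {S : Matrix n n ℂ}
    (hS : S.PosSemidef) {x : ℝ} (hx : ∀ i j, ‖A i j‖ ≤ x) :
    (A * S * Aᴴ).trace.re
      ≤ Fintype.card m * (Fintype.card n * (Fintype.card n * (x ^ 2 * S.trace.re))) := by
  rw [Matrix.trace, Complex.re_sum]
  simp only [Matrix.diag_apply, Matrix.mul_apply, Matrix.conjTranspose_apply, Finset.sum_mul,
    Complex.re_sum]
  refine (Finset.sum_le_card_nsmul _ _ _ fun i _ => ?_).trans_eq (nsmul_eq_mul _ _)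
  refine (Finset.sum_le_card_nsmul _ _ _ fun j _ => ?_).trans_eq (nsmul_eq_mul _ _)
  refine (Finset.sum_le_card_nsmul _ _ _ fun k _ => ?_).trans_eq (nsmul_eq_mul _ _)
  refine (Complex.re_le_norm _).trans ?_
  rw [norm_mul, norm_mul, norm_star, mul_right_comm, sq]
  have h0 : 0 ≤ x := (norm_nonneg _).trans (hx i k)
  exact mul_le_mul (mul_le_mul (hx _ _) (hx _ _) (norm_nonneg _) h0)
    (norm_apply_le_trace_of_posSemidef hS _ _) (norm_nonneg _) (mul_nonneg h0 h0)

lemma re_trace_mul_conjTranspose_le (A : Matrix n m ℂ) {x : ℝ} (hx : ∀ i j, ‖A i j‖ ≤ x) :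
    (A * Aᴴ).trace.re ≤ Fintype.card n * (Fintype.card m * x ^ 2) := by
  rw [Matrix.trace, Complex.re_sum]
  simp only [Matrix.diag_apply, Matrix.mul_apply, Matrix.conjTranspose_apply, Complex.re_sum]
  rw [← nsmul_eq_mul, ← Finset.card_univ, ← Finset.sum_const]
  refine Finset.sum_le_sum fun i _ => ?_
  rw [← nsmul_eq_mul, ← Finset.card_univ, ← Finset.sum_const]
  refine Finset.sum_le_sum fun j _ => (Complex.re_le_norm _).trans ?_
  rw [norm_mul, norm_star, sq]
  exact mul_le_mul (hx _ _) (hx _ _) (norm_nonneg _) ((norm_nonneg _).trans (hx i j))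

end Determinants

/-! ### Moments of the fading -/

section Moments

/-- The radial density turns moments of `‖z‖` into known planar integrals. -/
lemma stdComplexGaussian_eq_withDensity :
    stdComplexGaussian
      = volume.withDensity fun z : ℂ => ENNReal.ofReal (Real.pi⁻¹ * Real.exp (-‖z‖ ^ 2)) := by
  have h0 : (1 / 2 : NNReal) ≠ 0 := by norm_num
  rw [stdComplexGaussian, gaussianReal_of_var_ne_zero 0 h0,
    prod_withDensity (measurable_gaussianPDF _ _) (measurable_gaussianPDF _ _)]
  have he : (fun z : ℝ × ℝ => (⟨z.1, z.2⟩ : ℂ)) = Complex.measurableEquivRealProd.symm := by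
    funext z
    rfl
  have hd : (fun z : ℝ × ℝ => gaussianPDF 0 (1 / 2) z.1 * gaussianPDF 0 (1 / 2) z.2)
      = (fun z : ℂ => ENNReal.ofReal (Real.pi⁻¹ * Real.exp (-‖z‖ ^ 2)))
        ∘ Complex.measurableEquivRealProd.symm := by
    funext z
    simp only [gaussianPDF, Function.comp_apply]
    rw [← ENNReal.ofReal_mul (gaussianPDFReal_nonneg _ _ _)]
    congr 1
    have h1 : ‖Complex.measurableEquivRealProd.symm z‖ ^ 2 = z.1 ^ 2 + z.2 ^ 2 := by
      rw [Complex.sq_norm, Complex.normSq_apply]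
      simp [Complex.measurableEquivRealProd_symm_apply]
      ring
    rw [h1, gaussianPDFReal, gaussianPDFReal]
    have h2 : (√(2 * Real.pi * ((1 / 2 : NNReal) : ℝ)))⁻¹ * (√(2 * Real.pi * ((1 / 2 : NNReal) : ℝ)))⁻¹
        = Real.pi⁻¹ := by
      rw [← mul_inv, Real.mul_self_sqrt (by positivity)]
      congr 1
      push_cast
      ring
    rw [mul_mul_mul_comm, h2, ← Real.exp_add]
    congr 2
    push_cast
    ring
  rw [he, hd]
  ext A hA
  rw [MeasurableEquiv.map_apply, withDensity_apply _ hA,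
    withDensity_apply _ (Complex.measurableEquivRealProd.symm.measurable hA)]
  rw [← Measure.volume_eq_prod]
  exact Complex.volume_preserving_equiv_real_prod.symm.setLIntegral_comp_preimage_emb
    Complex.measurableEquivRealProd.symm.measurableEmbedding
    (fun z => ENNReal.ofReal (Real.pi⁻¹ * Real.exp (-‖z‖ ^ 2))) A

instance : IsProbabilityMeasure stdComplexGaussian :=
  Measure.isProbabilityMeasure_map (by
    have : (fun z : ℝ × ℝ => (⟨z.1, z.2⟩ : ℂ)) = Complex.measurableEquivRealProd.symm := rfl
    rw [this]
    exact Complex.measurableEquivRealProd.symm.measurable.aemeasurable)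

lemma lintegral_rpow_norm_lt_top {q : ℝ} (hq : -2 < q) :
    ∫⁻ z, ENNReal.ofReal (‖z‖ ^ q) ∂stdComplexGaussian < ∞ := by
  -- Non-integrable functions have integral `0` by convention, so positivity of the Gamma value
  -- proves integrability.
  have hpos : 0 < ∫ x : ℂ, ‖x‖ ^ q * Real.exp (-‖x‖ ^ (2 : ℝ)) := by
    rw [Complex.integral_rpow_mul_exp_neg_rpow one_le_two hq]
    have := Real.Gamma_pos_of_pos (show 0 < (q + 2) / 2 by linarith)
    have := Real.pi_pos
    positivity
  have hint : Integrable fun x : ℂ => ‖x‖ ^ q * Real.exp (-‖x‖ ^ (2 : ℝ)) := by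
    by_contra h
    rw [integral_undef h] at hpos
    exact lt_irrefl _ hpos
  rw [stdComplexGaussian_eq_withDensity, lintegral_withDensity_eq_lintegral_mul _ (by fun_prop)
    (by fun_prop)]
  refine lt_of_eq_of_lt (lintegral_congr fun z => ?_) (hint.const_mul Real.pi⁻¹).lintegral_lt_top
  rw [Pi.mul_apply, ← ENNReal.ofReal_mul (by positivity)]
  congr 1
  rw [Real.rpow_two]
  ring

/-- Negative moments of the fading of order less than `2` and all positive moments are finite. -/
lemma lintegral_one_add_norm_rpow_mul_lt_top {N q : ℝ} (hN : 0 ≤ N) (hq : q < 2) :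
    ∫⁻ z : ℂ, ENNReal.ofReal ((1 + ‖z‖) ^ N) * ENNReal.ofReal ‖z‖ ^ (-q) ∂stdComplexGaussian
      < ∞ := by
  -- At `0` the negative power is `∞` in `ℝ≥0∞` but `0` in `ℝ`, so this null set must be removed
  -- before comparing the two.
  have hne : ∀ᵐ z ∂stdComplexGaussian, z ≠ (0 : ℂ) := by
    rw [stdComplexGaussian_eq_withDensity]
    exact (withDensity_absolutelyContinuous _ _).ae_le (Measure.ae_ne volume 0)
  have hle : ∀ x : ℝ, 0 < x →
      (1 + x) ^ N * x ^ (-q) ≤ 2 ^ N * x ^ (-q) + 2 ^ N * x ^ (N - q) := by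
    intro x hx
    have h1 : (1 + x) ^ N ≤ 2 ^ N * (1 + x ^ N) := by
      rcases le_total x 1 with h | h
      · calc (1 + x) ^ N ≤ 2 ^ N := Real.rpow_le_rpow (by linarith) (by linarith) hN
          _ ≤ 2 ^ N * (1 + x ^ N) := le_mul_of_one_le_right (by positivity)
              (by linarith [Real.rpow_nonneg hx.le N])
      · calc (1 + x) ^ N ≤ (2 * x) ^ N := Real.rpow_le_rpow (by linarith) (by linarith) hN
          _ = 2 ^ N * x ^ N := Real.mul_rpow (by norm_num) hx.le
          _ ≤ 2 ^ N * (1 + x ^ N) := by gcongr; linarith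
    calc (1 + x) ^ N * x ^ (-q) ≤ 2 ^ N * (1 + x ^ N) * x ^ (-q) := by gcongr
      _ = 2 ^ N * x ^ (-q) + 2 ^ N * x ^ (N - q) := by
        rw [sub_eq_add_neg, Real.rpow_add hx]
        ring
  have hbd : ∫⁻ z : ℂ, (ENNReal.ofReal (2 ^ N) * ENNReal.ofReal (‖z‖ ^ (-q))
      + ENNReal.ofReal (2 ^ N) * ENNReal.ofReal (‖z‖ ^ (N - q))) ∂stdComplexGaussian < ∞ := by
    rw [lintegral_add_left (by fun_prop), lintegral_const_mul _ (by fun_prop),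
      lintegral_const_mul _ (by fun_prop)]
    exact ENNReal.add_lt_top.2
      ⟨ENNReal.mul_lt_top ENNReal.ofReal_lt_top (lintegral_rpow_norm_lt_top (by linarith)),
        ENNReal.mul_lt_top ENNReal.ofReal_lt_top (lintegral_rpow_norm_lt_top (by linarith))⟩
  refine (lintegral_mono_ae ?_).trans_lt hbd
  filter_upwards [hne] with z hz
  have hz' : 0 < ‖z‖ := norm_pos_iff.2 hz
  rw [ENNReal.ofReal_rpow_of_pos hz', ← ENNReal.ofReal_mul (by positivity),
    ← ENNReal.ofReal_mul (by positivity), ← ENNReal.ofReal_mul (by positivity),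
    ← ENNReal.ofReal_add (by positivity) (by positivity)]
  exact ENNReal.ofReal_le_ofReal (hle _ hz')

variable {ι : Type*} [Fintype ι]

lemma lintegral_pi_prod_lt_top {φ : ι → ℂ → ℝ≥0∞} (hφ : ∀ i, Measurable (φ i))
    (hfin : ∀ i, ∫⁻ z, φ i z ∂stdComplexGaussian < ∞) :
    ∫⁻ h : ι → ℂ, ∏ i, φ i (h i) ∂(Measure.pi fun _ => stdComplexGaussian) < ∞ := by
  rw [lintegral_prod_eq_prod_lintegral_of_indepFun Finset.univ
    (fun i (h : ι → ℂ) => φ i (h i)) (iIndepFun_pi fun i => (hφ i).aemeasurable)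
    fun i => (hφ i).comp (measurable_pi_apply i)]
  refine ENNReal.prod_lt_top fun i _ => ?_
  rw [(measurePreserving_eval (fun _ : ι => stdComplexGaussian) i).lintegral_comp (hφ i)]
  exact hfin i

end Moments

/-! ### Responses of amplify-and-forward protocols -/

namespace AFProtocol

variable {V : Type*} {P : AFProtocol V} {G : Digraph V} {s t : V} {h : V × V → ℂ} {x : ℕ → ℂ}
  {w : ℕ → V → ℂ}

lemma norm_send_le (hP : ∀ v, P.gain v ≤ 1) {τ : ℕ} {b : V → ℂ} {c : ℝ} (hc : 1 ≤ c)
    (hx : ‖x τ‖ ≤ 1) (hb : ∀ v, ‖b v‖ ≤ c) (v : V) : ‖P.send s t x τ b v‖ ≤ c := by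
  have hc0 : 0 ≤ c := zero_le_one.trans hc
  rw [send]
  split_ifs
  · exact hx.trans hc
  · rw [norm_mul, Complex.norm_real, Real.norm_of_nonneg (P.gain_pos v).le]
    exact (mul_le_mul (hP v) (hb v) (norm_nonneg _) zero_le_one).trans_eq (one_mul c)
  · simpa using hc0

lemma norm_single_le (σ τ : ℕ) : ‖(Pi.single σ 1 : ℕ → ℂ) τ‖ ≤ 1 := by
  by_cases h : τ = σ
  · subst h; simp
  · simp [h]

lemma norm_noiseImpulse_le [DecidableEq V] (e : V × ℕ) (τ : ℕ) (v : V) : ‖noiseImpulse e τ v‖ ≤ 1 := by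
  rw [noiseImpulse]
  by_cases h : τ = e.2
  · subst h
    rw [Pi.single_eq_same]
    by_cases h' : v = e.1
    · subst h'; simp
    · simp [h']
  · simp [h]

variable [Fintype V]

/-- A bound on the growth of the signals in a slot. -/
noncomputable def fadingBound (h : V × V → ℂ) : ℝ := ∏ e, (1 + ‖h e‖)

/-- Expanding the product gives `1`, every `‖h e‖` and nonnegative terms. A product is preferred to
the sum because its moments factor by independence. -/
lemma one_add_sum_le_fadingBound (h : V × V → ℂ) (v : V) :
    1 + ∑ u, ‖h (u, v)‖ ≤ fadingBound h := by
  classical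
  have h1 : ∑ u, ‖h (u, v)‖ ≤ ∑ e, ‖h e‖ := by
    rw [Fintype.sum_prod_type]
    exact Finset.sum_le_sum fun u _ => Finset.single_le_sum (f := fun w => ‖h (u, w)‖)
      (fun _ _ => norm_nonneg _) (Finset.mem_univ v)
  have h2 : ∀ A : Finset (V × V), 1 + ∑ e ∈ A, ‖h e‖ ≤ ∏ e ∈ A, (1 + ‖h e‖) := by
    intro A
    induction A using Finset.induction_on with
    | empty => simp
    | insert e A he ih =>
      rw [Finset.sum_insert he, Finset.prod_insert he]
      have h3 : 0 ≤ ∑ e ∈ A, ‖h e‖ := Finset.sum_nonneg fun _ _ => norm_nonneg _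
      nlinarith [norm_nonneg (h e)]
  linarith [h2 Finset.univ, show fadingBound h = ∏ e, (1 + ‖h e‖) from rfl]

lemma one_le_fadingBound (h : V × V → ℂ) : 1 ≤ fadingBound h :=
  Finset.one_le_prod fun e => by simp

open Classical in
lemma norm_receive_le {z : V → ℂ} {w : V → ℂ} {v : V} {b : ℝ} (hb : 1 ≤ b)
    (hz : ∀ u, ‖z u‖ ≤ b) (hw : ‖w v‖ ≤ 1) : ‖receive G h z w v‖ ≤ fadingBound h * b := by
  have hb0 : 0 ≤ b := zero_le_one.trans hb
  have h1 : ‖∑ u, if G.Adj u v then h (u, v) * z u else 0‖ ≤ (∑ u, ‖h (u, v)‖) * b := by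
    rw [Finset.sum_mul]
    refine (norm_sum_le _ _).trans (Finset.sum_le_sum fun u _ => ?_)
    split_ifs
    · rw [norm_mul]
      exact mul_le_mul_of_nonneg_left (hz u) (norm_nonneg _)
    · simpa using mul_nonneg (norm_nonneg _) hb0
  calc ‖receive G h z w v‖ ≤ (∑ u, ‖h (u, v)‖) * b + 1 := (norm_add_le _ _).trans (add_le_add h1 hw)
    _ ≤ (1 + ∑ u, ‖h (u, v)‖) * b := by linarith
    _ ≤ fadingBound h * b := mul_le_mul_of_nonneg_right (one_add_sum_le_fadingBound h v) hb0

lemma norm_buffer_le (hP : ∀ v, P.gain v ≤ 1) (hx : ∀ τ, ‖x τ‖ ≤ 1) (hw : ∀ τ v, ‖w τ v‖ ≤ 1)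
    (τ : ℕ) (v : V) : ‖P.buffer G s t h x w τ v‖ ≤ fadingBound h ^ τ := by
  induction τ generalizing v with
  | zero => simp [buffer]
  | succ τ ih =>
    have h1 := one_le_pow₀ (one_le_fadingBound h) (n := τ)
    rw [buffer, pow_succ']
    split_ifs
    · exact norm_receive_le h1 (norm_send_le hP h1 (hx τ) ih) (hw τ v)
    · exact (ih v).trans (le_mul_of_one_le_left (zero_le_one.trans h1) (one_le_fadingBound h))

lemma norm_observed_le (hP : ∀ v, P.gain v ≤ 1) (hx : ∀ τ, ‖x τ‖ ≤ 1)
    (hw : ∀ τ v, ‖w τ v‖ ≤ 1) (τ : ℕ) :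
    ‖P.observed G s t h x w τ‖ ≤ fadingBound h ^ (τ + 1) := by
  have h1 := one_le_pow₀ (one_le_fadingBound h) (n := τ)
  rw [observed, pow_succ']
  exact norm_receive_le h1 (norm_send_le hP h1 (hx τ) (norm_buffer_le hP hx hw τ)) (hw τ t)

/-- The last gain is kept as a factor, so that small gains make the relay energy small. -/
lemma norm_transmitted_le (hP : ∀ v, P.gain v ≤ 1) (hx : ∀ τ, ‖x τ‖ ≤ 1)
    (hw : ∀ τ v, ‖w τ v‖ ≤ 1) (τ : ℕ) {v : V} (hv : v ≠ s) :
    ‖P.transmitted G s t h x w τ v‖ ≤ P.gain v * fadingBound h ^ τ := by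
  have h0 := (P.gain_pos v).le
  have h1 := one_le_pow₀ (one_le_fadingBound h) (n := τ)
  rw [transmitted, send, if_neg hv]
  split_ifs
  · rw [norm_mul, Complex.norm_real, Real.norm_of_nonneg h0]
    exact mul_le_mul_of_nonneg_left (norm_buffer_le hP hx hw τ v) h0
  · simpa using mul_nonneg h0 (zero_le_one.trans h1)

/-- Causality: without noise, buffers stay empty until the source sends something nonzero. -/
lemma buffer_eq_zero {τ : ℕ} (hx : ∀ σ < τ, x σ = 0) (v : V) :
    P.buffer G s t h x 0 τ v = 0 := by
  induction τ generalizing v with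
  | zero => rfl
  | succ τ ih =>
    have h1 := ih fun σ hσ => hx σ (hσ.trans τ.lt_succ_self)
    rw [buffer, h1 v, receive]
    simp [send, hx τ τ.lt_succ_self, h1]

lemma observed_eq_zero {τ : ℕ} (hx : ∀ σ ≤ τ, x σ = 0) : P.observed G s t h x 0 τ = 0 := by
  have h1 := buffer_eq_zero (P := P) (G := G) (s := s) (t := t) (h := h) (τ := τ)
    fun σ hσ => hx σ hσ.le
  simp [observed, receive, transmitted, send, hx τ le_rfl, h1]

/-- The sink never transmits, so its noise reaches no other node. Its noise columns therefore form
an identity matrix, the white component used in the determinant bounds. -/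
lemma buffer_eq_zero_of_sink_noise (hw : ∀ τ v, v ≠ t → w τ v = 0) (τ : ℕ) {v : V}
    (hv : v ≠ t) : P.buffer G s t h 0 w τ v = 0 := by
  induction τ generalizing v with
  | zero => rfl
  | succ τ ih =>
    rw [buffer, ih hv, receive, hw τ v hv]
    have : ∀ u, P.send s t 0 τ (P.buffer G s t h 0 w τ) u = 0 := by
      intro u
      rw [send]
      split_ifs with h1 h2
      · rfl
      · rw [ih h1.2, mul_zero]
      · rfl
    simp [this]

lemma observed_of_sink_noise (hw : ∀ τ v, v ≠ t → w τ v = 0) (τ : ℕ) :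
    P.observed G s t h 0 w τ = w τ t := by
  have : ∀ u, P.transmitted G s t h 0 w τ u = 0 := by
    intro u
    rw [transmitted, send]
    split_ifs with h1 h2
    · rfl
    · rw [buffer_eq_zero_of_sink_noise hw τ h1.2, mul_zero]
    · rfl
  simp [observed, receive, this]

variable [DecidableEq V]

lemma noiseMatrix_sink (P : AFProtocol V) (i j : Fin P.duration) :
    P.noiseMatrix G s t h i (t, j) = if i = j then 1 else 0 := by
  rw [noiseMatrix, Matrix.of_apply, observed_of_sink_noise]
  · rw [noiseImpulse]
    by_cases hij : i = j
    · subst hij; simp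
    · have : (i : ℕ) ≠ j := fun h' => hij (Fin.ext h')
      simp [hij, this]
  · intro τ v hv
    rw [noiseImpulse]
    by_cases h' : τ = j
    · subst h'; simp [hv]
    · simp [h']

lemma norm_noiseMatrix_le (hP : ∀ v, P.gain v ≤ 1) (i : Fin P.duration)
    (e : V × Fin P.duration) : ‖P.noiseMatrix G s t h i e‖ ≤ fadingBound h ^ P.duration :=
  (norm_observed_le hP (fun _ => by simp) (norm_noiseImpulse_le _) _).trans
    (pow_le_pow_right₀ (one_le_fadingBound h) i.2)

lemma noiseCov_det_le (hP : ∀ v, P.gain v ≤ 1) :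
    (P.noiseCov G s t h).det.re ≤ P.duration.factorial *
      (Fintype.card (V × Fin P.duration) * (fadingBound h ^ P.duration) ^ 2) ^ P.duration := by
  rw [noiseCov]
  simpa using re_det_mul_conjTranspose_le (P.noiseMatrix G s t h) (norm_noiseMatrix_le hP)

lemma one_le_noiseCov_det : 1 ≤ (P.noiseCov G s t h).det.re :=
  one_le_det_mul_conjTranspose _ (fun j => (t, j)) (noiseMatrix_sink P)

lemma relayEnergy_le {a : ℝ} (ha : a ≤ 1) (hP : ∀ v, P.gain v = a) {v : V} (hv : v ≠ s)
    {S : Matrix (Fin P.duration) (Fin P.duration) ℂ} {ρ : ℝ} (hρ : 1 ≤ ρ)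
    (hS : S ∈ P.inputCovs ρ) :
    P.relayEnergy G s t h v S ≤ a ^ 2 * (P.duration ^ 3 + Fintype.card V * P.duration ^ 2)
      * (fadingBound h ^ P.duration) ^ 2 * (P.duration * ρ) := by
  have ha0 : 0 < a := hP v ▸ P.gain_pos v
  have hP' : ∀ v, P.gain v ≤ 1 := fun v => (hP v).trans_le ha
  have hb : ∀ i : Fin P.duration, fadingBound h ^ (i : ℕ) ≤ fadingBound h ^ P.duration :=
    fun i => pow_le_pow_right₀ (one_le_fadingBound h) i.2.le
  have h1 := re_trace_mul_mul_conjTranspose_le (P.relaySignalMatrix G s t h v) hS.1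
    (x := a * fadingBound h ^ P.duration) fun i j => by
      refine (norm_transmitted_le hP' (norm_single_le _) (fun _ _ => by simp) _ hv).trans ?_
      rw [hP v]
      exact mul_le_mul_of_nonneg_left (hb i) ha0.le
  have h2 := re_trace_mul_conjTranspose_le (P.relayNoiseMatrix G s t h v)
    (x := a * fadingBound h ^ P.duration) fun i j => by
      refine (norm_transmitted_le hP' (fun _ => by simp) (norm_noiseImpulse_le _) _ hv).trans ?_
      rw [hP v]
      exact mul_le_mul_of_nonneg_left (hb i) ha0.le
  rw [relayEnergy, Matrix.trace_add, Complex.add_re]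
  refine (add_le_add h1 h2).trans ?_
  simp only [Fintype.card_fin, Fintype.card_prod]
  push_cast
  have hn : (1 : ℝ) ≤ P.duration := by exact_mod_cast P.duration_pos
  -- This lets the forwarded noise, which does not scale with `ρ`, be charged to the power budget.
  have h3 : (1 : ℝ) ≤ P.duration * ρ := by nlinarith
  set n : ℝ := (P.duration : ℝ)
  set X := fadingBound h ^ P.duration
  have h4 : n * (n * (n * ((a * X) ^ 2 * S.trace.re))) ≤ n ^ 3 * (a * X) ^ 2 * (n * ρ) := by
    rw [show n * (n * (n * ((a * X) ^ 2 * S.trace.re))) = n ^ 3 * (a * X) ^ 2 * S.trace.re by ring]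
    exact mul_le_mul_of_nonneg_left hS.2 (by positivity)
  have h5 : n * (Fintype.card V * n * (a * X) ^ 2)
      ≤ (Fintype.card V * n ^ 2 * (a * X) ^ 2) * (n * ρ) := by
    rw [show n * (Fintype.card V * n * (a * X) ^ 2)
      = Fintype.card V * n ^ 2 * (a * X) ^ 2 by ring]
    exact le_mul_of_one_le_right (by positivity) h3
  refine (add_le_add h4 h5).trans_eq ?_
  ring

/-- An AF protocol with small enough gains obeys the energy constraint. -/
lemma meetsEnergyConstraint_of_le {a : ℝ} (ha : a ≤ 1) (hP : ∀ v, P.gain v = a)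
    (hE : ENNReal.ofReal (a ^ 2 * (P.duration ^ 3 + Fintype.card V * P.duration ^ 2))
      * ∫⁻ h, ENNReal.ofReal ((fadingBound h ^ P.duration) ^ 2) ∂(fadingLaw V) ≤ 1) :
    P.MeetsEnergyConstraint G s t := by
  intro ρ hρ S hS v hvs _
  have hm : Measurable fun h : V × V → ℂ =>
      ENNReal.ofReal ((fadingBound h ^ P.duration) ^ 2) := by
    unfold fadingBound
    fun_prop
  calc ∫⁻ h, ENNReal.ofReal (P.relayEnergy G s t h v S) ∂(fadingLaw V)
      ≤ ∫⁻ h, ENNReal.ofReal (a ^ 2 * (P.duration ^ 3 + Fintype.card V * P.duration ^ 2))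
        * ENNReal.ofReal ((fadingBound h ^ P.duration) ^ 2) * ENNReal.ofReal (P.duration * ρ)
          ∂(fadingLaw V) := by
        refine lintegral_mono fun h => ?_
        rw [← ENNReal.ofReal_mul (by positivity), ← ENNReal.ofReal_mul (by positivity)]
        exact ENNReal.ofReal_le_ofReal (relayEnergy_le ha hP hvs hρ hS)
    _ = (ENNReal.ofReal (a ^ 2 * (P.duration ^ 3 + Fintype.card V * P.duration ^ 2))
        * ∫⁻ h, ENNReal.ofReal ((fadingBound h ^ P.duration) ^ 2) ∂(fadingLaw V))
          * ENNReal.ofReal (P.duration * ρ) := by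
        rw [lintegral_mul_const _ (by fun_prop), lintegral_const_mul _ hm]
    _ ≤ 1 * ENNReal.ofReal (P.duration * ρ) := by gcongr
    _ = ENNReal.ofReal (P.duration * ρ) := one_mul _

end AFProtocol

/-! ### Sequential activation of paths -/

namespace AFProtocol

variable {V : Type*} [Fintype V] {G : Digraph V} {s t : V} {h : V × V → ℂ}

/-- The product of the fading coefficients along the first `d` edges of the path `q`, with the
gain `a` at each of the first `d` relays. -/
noncomputable def pathGain (a : ℝ) (h : V × V → ℂ) (q : ℕ → V) (d : ℕ) : ℂ :=
  (a : ℂ) ^ d * ∏ j ∈ Finset.range d, h (q j, q (j + 1))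

/-- `Good d i` marks the delays `d` and positions `i` at which the response is controlled. By
`hstep`, a good position at delay `d + 1` hears only good positions at delay `d`, and hears position
`d` only if it is its successor. The two instances used are `i ≤ d` (all edges lead forward) and `d
≤ i` (no edge skips a node). -/
lemma receive_path {a : ℝ} {q : ℕ → V} {L d i : ℕ} {z : V → ℂ} {Good : ℕ → ℕ → Prop}
    (hinj : ∀ i ≤ L, ∀ j ≤ L, q i = q j → i = j)
    (hadj : ∀ i < L, G.Adj (q i) (q (i + 1)))
    (hstep : ∀ d i j, i ≤ L → j ≤ L → Good (d + 1) i → G.Adj (q j) (q i) →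
      Good d j ∧ (j = d → i = d + 1))
    (hz : ∀ u, (∀ j < L, u ≠ q j) → z u = 0)
    (hzq : ∀ j < L, Good d j → z (q j) = if d = j then pathGain a h q d else 0)
    (hi : i ≤ L) (hgood : Good (d + 1) i) :
    receive G h z 0 (q i) = if d + 1 = i then pathGain a h q d * h (q d, q (d + 1)) else 0 := by
  classical
  have hterm : ∀ u, (if G.Adj u (q i) then h (u, q i) * z u else 0)
      = if u = q d ∧ d + 1 = i then pathGain a h q d * h (q d, q (d + 1)) else 0 := by
    intro u
    by_cases hu : ∃ j < L, u = q j
    · obtain ⟨j, hj, rfl⟩ := hu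
      by_cases hA : G.Adj (q j) (q i)
      · obtain ⟨h1, h2⟩ := hstep d i j hi hj.le hgood hA
        rw [if_pos hA, hzq j hj h1]
        by_cases hjd : d = j
        · subst hjd
          have := h2 rfl
          subst this
          simp [mul_comm]
        · have : ¬ (q j = q d ∧ d + 1 = i) := fun h3 =>
            hjd (hinj j hj.le d (by omega) h3.1).symm
          simp [hjd, this]
      · have : ¬ (q j = q d ∧ d + 1 = i) := by
          rintro ⟨h3, rfl⟩
          exact hA (h3 ▸ hadj d (by omega))
        simp [hA, this]
    · push Not at hu
      have : ¬ (u = q d ∧ d + 1 = i) := by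
        rintro ⟨rfl, rfl⟩
        exact hu d (by omega) rfl
      simp [hz u hu, this]
  rw [receive]
  simp only [hterm, Pi.zero_apply, add_zero]
  by_cases hd : d + 1 = i <;> simp [hd]

/-- The response of the nodes of a path to an impulse of the source while the path is active. -/
lemma transmitted_path {P : AFProtocol V} {a : ℝ} (hl : ∀ τ, P.listens τ = Set.univ)
    (hgain : ∀ v, P.gain v = a) {q : ℕ → V} {L σ D : ℕ} {Good : ℕ → ℕ → Prop}
    (hq0 : q 0 = s) (hqL : q L = t) (hL : 0 < L)
    (hinj : ∀ i ≤ L, ∀ j ≤ L, q i = q j → i = j)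
    (hadj : ∀ i < L, G.Adj (q i) (q (i + 1)))
    (hstep : ∀ d i j, i ≤ L → j ≤ L → Good (d + 1) i → G.Adj (q j) (q i) →
      Good d j ∧ (j = d → i = d + 1))
    (htr : ∀ d ≤ D, P.transmits (σ + d) = {v | ∃ i ≤ L, v = q i}) (d : ℕ) (hd : d ≤ D) (i : ℕ)
    (hi : i < L) (hgood : Good d i) :
    P.transmitted G s t h (Pi.single σ 1) 0 (σ + d) (q i)
      = if d = i then pathGain a h q d else 0 := by
  have hmem : ∀ d ≤ D, ∀ i < L, q i ∈ P.transmits (σ + d) ∧ q i ≠ t := by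
    intro d hd i hi
    refine ⟨by rw [htr d hd]; exact ⟨i, hi.le, rfl⟩, fun h => ?_⟩
    have := hinj i hi.le L le_rfl (h.trans hqL.symm)
    omega
  have hsrc : ∀ i < L, q i = s ↔ i = 0 := by
    intro i hi
    refine ⟨fun h => hinj i hi.le 0 hL.le (h.trans hq0.symm), ?_⟩
    rintro rfl
    exact hq0
  induction d generalizing i with
  | zero =>
    rw [transmitted, send, if_pos (hmem 0 hd i hi)]
    by_cases h0 : i = 0
    · subst h0
      simp [hq0, pathGain]
    · rw [if_neg fun h => h0 ((hsrc i hi).1 h), if_neg (Ne.symm h0), add_zero,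
        buffer_eq_zero fun τ hτ => Pi.single_eq_of_ne hτ.ne _, mul_zero]
  | succ d ih =>
    have hd' : d ≤ D := by omega
    rw [transmitted, send, if_pos (hmem _ hd i hi)]
    by_cases h0 : i = 0
    · subst h0
      simp [hq0]
    · rw [if_neg fun h => h0 ((hsrc i hi).1 h), ← add_assoc, buffer, hl, if_pos (Set.mem_univ _)]
      have h1 := receive_path (G := G) (h := h) (a := a) hinj hadj hstep
        (z := P.transmitted G s t h (Pi.single σ 1) 0 (σ + d)) (fun u hu => ?_)
        (fun j hj hg => ih hd' j hj hg) hi.le hgood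
      · change (P.gain (q i) : ℂ) * receive G h (P.transmitted G s t h (Pi.single σ 1) 0 (σ + d)) 0
          (q i) = _
        rw [h1, hgain]
        by_cases hdi : d + 1 = i
        · rw [if_pos hdi, if_pos hdi, pathGain, pathGain, Finset.prod_range_succ, pow_succ]
          ring
        · rw [if_neg hdi, if_neg hdi, mul_zero]
      · rw [transmitted, send, if_neg]
        rw [htr d hd']
        rintro ⟨⟨j, hj, rfl⟩, hne⟩
        refine hu j (lt_of_le_of_ne hj fun h => ?_) rfl
        subst h
        exact hne hqL

/-- The last hop takes place within slot `σ + D`, so the sink is reached at `D + 1 = L`, after `L`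
edges but only `L - 1` relays. -/
lemma observed_path {P : AFProtocol V} {a : ℝ} (hl : ∀ τ, P.listens τ = Set.univ)
    (hgain : ∀ v, P.gain v = a) {q : ℕ → V} {L σ D : ℕ} {Good : ℕ → ℕ → Prop}
    (hq0 : q 0 = s) (hqL : q L = t) (hL : 0 < L)
    (hinj : ∀ i ≤ L, ∀ j ≤ L, q i = q j → i = j)
    (hadj : ∀ i < L, G.Adj (q i) (q (i + 1)))
    (hstep : ∀ d i j, i ≤ L → j ≤ L → Good (d + 1) i → G.Adj (q j) (q i) →
      Good d j ∧ (j = d → i = d + 1))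
    (htr : ∀ d ≤ D, P.transmits (σ + d) = {v | ∃ i ≤ L, v = q i})
    (hgood : Good (D + 1) L) :
    P.observed G s t h (Pi.single σ 1) 0 (σ + D)
      = if D + 1 = L then (a : ℂ) ^ (L - 1) * ∏ j ∈ Finset.range L, h (q j, q (j + 1)) else 0 := by
  have h1 := receive_path (G := G) (h := h) (a := a) hinj hadj hstep
    (z := P.transmitted G s t h (Pi.single σ 1) 0 (σ + D)) (fun u hu => ?_)
    (fun j hj hg => transmitted_path hl hgain hq0 hqL hL hinj hadj hstep htr D le_rfl j hj hg)
    le_rfl hgood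
  · rw [hqL] at h1
    change receive G h (P.transmitted G s t h (Pi.single σ 1) 0 (σ + D)) 0 t = _
    rw [h1]
    by_cases hD : D + 1 = L
    · subst hD
      simp [pathGain, Finset.prod_range_succ, mul_assoc]
    · rw [if_neg hD, if_neg hD]
  · rw [transmitted, send, if_neg]
    rw [htr D le_rfl]
    rintro ⟨⟨j, hj, rfl⟩, hne⟩
    refine hu j (lt_of_le_of_ne hj fun h => ?_) rfl
    subst h
    exact hne hqL

/-- Edge-disjoint paths `q k 0, …, q k (L k)` from `s` to `t` that are either such that edges of
`G` between nodes of a path lead forward, or such that they skip no node of the path. -/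
structure IsPathSystem (G : Digraph V) (s t : V) {M : ℕ} (L : Fin M → ℕ) (q : Fin M → ℕ → V) :
    Prop where
  pos : ∀ k, 0 < L k
  lt : ∀ k, L k < Fintype.card V
  source : ∀ k, q k 0 = s
  sink : ∀ k, q k (L k) = t
  inj : ∀ k, ∀ i ≤ L k, ∀ j ≤ L k, q k i = q k j → i = j
  adj : ∀ k, ∀ i < L k, G.Adj (q k i) (q k (i + 1))
  edge_inj : ∀ k l, ∀ i < L k, ∀ j < L l, q k i = q l j → q k (i + 1) = q l (j + 1) →
    k = l ∧ i = j
  noskip : (∀ k, ∀ i ≤ L k, ∀ j ≤ L k, G.Adj (q k j) (q k i) → j < i) ∨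
    ∀ k, ∀ i ≤ L k, ∀ j ≤ L k, G.Adj (q k j) (q k i) → i ≤ j + 1

/-- The protocol that activates the paths `q k` one after the other, each for `T + |V|` slots. -/
noncomputable def pathProtocol {M : ℕ} (L : Fin M → ℕ) (q : Fin M → ℕ → V) (T : ℕ) (a : ℝ)
    (ha : 0 < a) : AFProtocol V where
  -- The `|V|` spare slots per block let the last of `T` symbols cross the path; the final `+ 1`
  -- keeps the duration positive for `M = 0`.
  duration := M * (T + Fintype.card V) + 1
  duration_pos := Nat.succ_pos _
  transmits τ := {v | ∃ k : Fin M, τ / (T + Fintype.card V) = k ∧ ∃ i ≤ L k, v = q k i}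
  listens _ := Set.univ
  gain _ := a
  gain_pos _ := ha

section PathProtocol

variable {M : ℕ} {L : Fin M → ℕ} {q : Fin M → ℕ → V} {T : ℕ} {a : ℝ} {ha : 0 < a}

lemma pathProtocol_transmits (k : Fin M) {d : ℕ} (hd : d < T + Fintype.card V) :
    (pathProtocol L q T a ha).transmits (k * (T + Fintype.card V) + d)
      = {v | ∃ i ≤ L k, v = q k i} := by
  have h1 : (k * (T + Fintype.card V) + d) / (T + Fintype.card V) = k := by
    rw [mul_comm, Nat.mul_add_div (by omega), Nat.div_eq_of_lt hd, add_zero]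
  ext v
  simp only [pathProtocol, Set.mem_ofPred_eq, h1]
  constructor
  · rintro ⟨l, hl, h⟩
    rwa [Fin.ext hl]
  · exact fun h => ⟨k, rfl, h⟩

/-- The product of the fading coefficients along all the paths, up to the gains. -/
noncomputable def pathsGain (a : ℝ) (h : V × V → ℂ) (L : Fin M → ℕ) (q : Fin M → ℕ → V) : ℂ :=
  ∏ k, ((a : ℂ) ^ (L k - 1) * ∏ j ∈ Finset.range (L k), h (q k j, q k (j + 1)))

/-- The channel matrix has a minor which is triangular and on whose diagonal the gain of each path
appears `T` times. -/
lemma exists_minor (hq : IsPathSystem G s t L q) :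
    ∃ R C : Fin M × Fin T → Fin (pathProtocol L q T a ha).duration,
      Function.Injective R ∧ Function.Injective C ∧ ∀ h : V × V → ℂ,
        (((pathProtocol L q T a ha).channelMatrix G s t h).submatrix R C).det
          = pathsGain a h L q ^ T := by
  set P := pathProtocol L q T a ha with hP
  set W := T + Fintype.card V with hW
  have hlt : ∀ (k : Fin M) (d : ℕ), d < W → k * W + d < P.duration := by
    intro k d hd
    have h1 : ((k : ℕ) + 1) * W ≤ M * W := Nat.mul_le_mul_right _ k.2
    change _ < M * W + 1
    nlinarith
  have hinj : ∀ k l d e : ℕ, d < W → e < W → k * W + d = l * W + e → k = l ∧ d = e := by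
    intro k l d e hd he h
    have h1 : (k * W + d) / W = k := by
      rw [mul_comm, Nat.mul_add_div (by omega), Nat.div_eq_of_lt hd, add_zero]
    have h2 : (l * W + e) / W = l := by
      rw [mul_comm, Nat.mul_add_div (by omega), Nat.div_eq_of_lt he, add_zero]
    have h3 : k = l := by rw [← h1, h, h2]
    subst h3
    exact ⟨rfl, by omega⟩
  have hr : ∀ i : Fin M × Fin T, (i.2 : ℕ) + (L i.1 - 1) < W := by
    intro i
    have := hq.lt i.1
    have := i.2.2
    omega
  have hc : ∀ i : Fin M × Fin T, (i.2 : ℕ) < W := by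
    intro i
    have := i.2.2
    omega
  -- Columns are the first `T` slots of each block; rows are delayed by `L k - 1`, the travel time
  -- along the path.
  let R : Fin M × Fin T → Fin P.duration := fun i => ⟨_, hlt i.1 _ (hr i)⟩
  let C : Fin M × Fin T → Fin P.duration := fun i => ⟨_, hlt i.1 _ (hc i)⟩
  refine ⟨R, C, ?_, ?_, fun h => ?_⟩
  · rintro ⟨k, j⟩ ⟨l, j'⟩ hkl
    obtain ⟨h1, h2⟩ := hinj _ _ _ _ (hr _) (hr _) (Fin.ext_iff.1 hkl)
    have h3 : k = l := Fin.ext h1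
    subst h3
    simp only at h2
    rw [Prod.mk.injEq]
    exact ⟨rfl, Fin.ext (by omega)⟩
  · rintro ⟨k, j⟩ ⟨l, j'⟩ hkl
    obtain ⟨h1, h2⟩ := hinj _ _ _ _ (hc _) (hc _) (Fin.ext_iff.1 hkl)
    exact Prod.ext (Fin.ext h1) (Fin.ext h2)
  set X := (P.channelMatrix G s t h).submatrix R C with hX
  have hXapp : ∀ i j, X i j = P.observed G s t h (Pi.single (j.1 * W + j.2 : ℕ) 1) 0
      (i.1 * W + (i.2 + (L i.1 - 1))) := fun i j => rfl
  have hcausal : ∀ i j : Fin M × Fin T, (i.1 : ℕ) * W + (i.2 + (L i.1 - 1)) < j.1 * W + j.2 →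
      X i j = 0 := by
    intro i j hij
    rw [hXapp, observed_eq_zero]
    intro σ hσ
    exact Pi.single_eq_of_ne (by omega) _
  have hblock : ∀ i j : Fin M × Fin T, i.1 < j.1 → X i j = 0 := by
    intro i j hij
    apply hcausal
    have h1 : ((i.1 : ℕ) + 1) * W ≤ j.1 * W := Nat.mul_le_mul_right _ hij
    have := hr i
    nlinarith
  have hobs : ∀ (Good : ℕ → ℕ → Prop) (k : Fin M) (j j' : Fin T),
      (∀ d i j, i ≤ L k → j ≤ L k → Good (d + 1) i → G.Adj (q k j) (q k i) →
        Good d j ∧ (j = d → i = d + 1)) → (j' : ℕ) ≤ j + (L k - 1) →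
      Good (j + (L k - 1) - j' + 1) (L k) →
      X (k, j) (k, j') = if j = j' then
        (a : ℂ) ^ (L k - 1) * ∏ j ∈ Finset.range (L k), h (q k j, q k (j + 1)) else 0 := by
    intro Good k j j' hstep hle hgood
    have h1 := observed_path (P := P) (G := G) (s := s) (t := t) (h := h) (a := a)
      (fun _ => rfl) (fun _ => rfl) (hq.source k) (hq.sink k) (hq.pos k) (hq.inj k) (hq.adj k)
      hstep (σ := k * W + j') (D := j + (L k - 1) - j') (fun d hd => ?_) hgood
    · rw [hXapp]
      have h2 : (k : ℕ) * W + j' + (j + (L k - 1) - j') = k * W + (j + (L k - 1)) := by omega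
      rw [h2] at h1
      refine h1.trans ?_
      have hpos := hq.pos k
      have h3 : (j : ℕ) + (L k - 1) - j' + 1 = L k ↔ j = j' := by
        rw [Fin.ext_iff]
        omega
      simp only [h3]
    · rw [add_assoc]
      have := hr (k, j)
      simp only at this
      exact pathProtocol_transmits k (by omega)
  have hfinal : ∀ b : Fin M × Fin T → ℕ, Function.Injective b →
      (∀ i j, b i < b j → X i j = 0) →
      (∀ k j, X (k, j) (k, j) = (a : ℂ) ^ (L k - 1) *
        ∏ j ∈ Finset.range (L k), h (q k j, q k (j + 1))) → X.det = pathsGain a h L q ^ T := by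
    intro b hb htri hdiag
    rw [det_eq_prod_diag b hb htri, Fintype.prod_prod_type, pathsGain, ← Finset.prod_pow]
    refine Finset.prod_congr rfl fun k _ => ?_
    simp [hdiag]
  have hlex : ∀ (k l d e : ℕ), d < T → k * T + d < l * T + e → e < T → k < l ∨ (k = l ∧ d < e) := by
    intro k l d e hd h he
    rcases lt_trichotomy k l with h1 | h1 | h1
    · exact Or.inl h1
    · subst h1
      exact Or.inr ⟨rfl, by omega⟩
    · have : (l + 1) * T ≤ k * T := Nat.mul_le_mul_right _ h1
      nlinarith
  have hlexinj : ∀ (k l d e : ℕ), d < T → e < T → k * T + d = l * T + e → k = l ∧ d = e := by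
    intro k l d e hd he h
    have h1 : (k * T + d) / T = k := by
      rw [mul_comm, Nat.mul_add_div (by omega), Nat.div_eq_of_lt hd, add_zero]
    have h2 : (l * T + e) / T = l := by
      rw [mul_comm, Nat.mul_add_div (by omega), Nat.div_eq_of_lt he, add_zero]
    have h3 : k = l := by rw [← h1, h, h2]
    subst h3
    exact ⟨rfl, by omega⟩
  rcases hq.noskip with hfwd | hskip
  -- Each hop advances by at least one position, so nothing arrives late: within a block the entries
  -- with `j' < j` vanish, whence the reversed order `T - 1 - i.2` below.
  · have hstep : ∀ k, ∀ d i j, i ≤ L k → j ≤ L k → i ≤ d + 1 → G.Adj (q k j) (q k i) →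
        j ≤ d ∧ (j = d → i = d + 1) := by
      intro k d i j hi hj hg hA
      have := hfwd k i hi j hj hA
      omega
    refine hfinal (fun i => i.1 * T + (T - 1 - i.2)) ?_ ?_ ?_
    · rintro ⟨k, j⟩ ⟨l, j'⟩ hkl
      have hj := j.2
      have hj' := j'.2
      obtain ⟨h1, h2⟩ := hlexinj _ _ _ _ (by simp only; omega) (by simp only; omega) hkl
      simp only at h2
      exact Prod.ext (Fin.ext h1) (Fin.ext (by simp only; omega))
    · rintro ⟨k, j⟩ ⟨l, j'⟩ hkl
      have hj := j.2
      have hj' := j'.2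
      rcases hlex _ _ _ _ (by simp only; omega) hkl (by simp only; omega) with h1 | ⟨h1, h2⟩
      · exact hblock _ _ h1
      · have h3 : k = l := Fin.ext h1
        subst h3
        simp only at h2
        rw [hobs (fun d i => i ≤ d) k j j' (hstep k) (by omega)
          (by have := hq.pos k; omega), if_neg]
        rintro rfl
        omega
    · intro k j
      rw [hobs (fun d i => i ≤ d) k j j (hstep k) (by omega)
          (by have := hq.pos k; omega), if_pos rfl]
  -- Each hop advances by at most one position, so nothing arrives early: within a block the entries
  -- with `j < j'` vanish.
  · have hstep : ∀ k, ∀ d i j, i ≤ L k → j ≤ L k → d + 1 ≤ i → G.Adj (q k j) (q k i) →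
        d ≤ j ∧ (j = d → i = d + 1) := by
      intro k d i j hi hj hg hA
      have := hskip k i hi j hj hA
      omega
    refine hfinal (fun i => i.1 * T + i.2) ?_ ?_ ?_
    · rintro ⟨k, j⟩ ⟨l, j'⟩ hkl
      obtain ⟨h1, h2⟩ := hlexinj _ _ _ _ j.2 j'.2 hkl
      exact Prod.ext (Fin.ext h1) (Fin.ext h2)
    · rintro ⟨k, j⟩ ⟨l, j'⟩ hkl
      rcases hlex _ _ _ _ j.2 hkl j'.2 with h1 | ⟨h1, h2⟩
      · exact hblock _ _ h1
      · have h3 : k = l := Fin.ext h1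
        subst h3
        simp only at h2
        -- Beyond this range the natural subtraction defining the delay would truncate; causality
        -- applies instead.
        by_cases hle : (j' : ℕ) ≤ j + (L k - 1)
        · rw [hobs (fun d i => d ≤ i) k j j' (hstep k) hle
            (by have := hq.pos k; omega), if_neg]
          rintro rfl
          omega
        · apply hcausal
          simp only
          omega
    · intro k j
      rw [hobs (fun d i => d ≤ i) k j j (hstep k) (by omega)
          (by have := hq.pos k; omega), if_pos rfl]

end PathProtocol

end AFProtocol

/-! ### The outage exponent -/

namespace AFProtocol

variable {V : Type*} [Fintype V] {G : Digraph V} {s t : V}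

lemma lintegral_fadingBound_lt_top (n : ℕ) :
    ∫⁻ h, ENNReal.ofReal ((fadingBound h ^ n) ^ 2) ∂(fadingLaw V) < ∞ := by
  have h1 := lintegral_pi_prod_lt_top (ι := V × V)
    (φ := fun _ z => ENNReal.ofReal ((1 + ‖z‖) ^ ((n * 2 : ℕ) : ℝ))
      * ENNReal.ofReal ‖z‖ ^ (-(0 : ℝ)))
    (fun _ => by fun_prop)
    (fun _ => lintegral_one_add_norm_rpow_mul_lt_top (by positivity) two_pos)
  refine lt_of_eq_of_lt (lintegral_congr fun h => ?_) h1
  simp only [neg_zero, ENNReal.rpow_zero, mul_one, Real.rpow_natCast]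
  rw [← ENNReal.ofReal_prod_of_nonneg fun _ _ => by positivity, Finset.prod_pow, ← pow_mul,
    fadingBound]

/-- Gains that are small enough for the energy constraint. -/
lemma exists_gain (n : ℕ) : ∃ a : ℝ, 0 < a ∧ a ≤ 1 ∧
    ENNReal.ofReal (a ^ 2 * (n ^ 3 + Fintype.card V * n ^ 2))
      * ∫⁻ h, ENNReal.ofReal ((fadingBound h ^ n) ^ 2) ∂(fadingLaw V) ≤ 1 := by
  have hfin := (lintegral_fadingBound_lt_top (V := V) n).ne
  set I := ∫⁻ h, ENNReal.ofReal ((fadingBound h ^ n) ^ 2) ∂(fadingLaw V)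
  set c : ℝ := n ^ 3 + Fintype.card V * n ^ 2
  have hc : 0 ≤ c := by positivity
  obtain ⟨J, hI, hJ⟩ : ∃ J : ℝ, 0 ≤ J ∧ I = ENNReal.ofReal J :=
    ⟨I.toReal, ENNReal.toReal_nonneg, (ENNReal.ofReal_toReal hfin).symm⟩
  have hd : 0 < 1 + c * J := by positivity
  have ha1 : (1 + c * J)⁻¹ ≤ 1 := inv_le_one_of_one_le₀ (by nlinarith [mul_nonneg hc hI])
  -- As `a ≤ 1`, `a ^ 2 * c * J ≤ a * (c * J) ≤ 1`. The gain does not depend on `ρ`, so it does not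
  -- affect the exponent.
  refine ⟨(1 + c * J)⁻¹, by positivity, ha1, ?_⟩
  rw [hJ, ← ENNReal.ofReal_mul (by positivity), ENNReal.ofReal_le_one]
  set a := (1 + c * J)⁻¹
  have ha0 : 0 < a := by positivity
  have h1 : a * (1 + c * J) = 1 := inv_mul_cancel₀ hd.ne'
  have h2 : a ^ 2 ≤ a := by nlinarith
  calc a ^ 2 * c * J = a ^ 2 * (c * J) := by ring
    _ ≤ a * (c * J) := mul_le_mul_of_nonneg_right h2 (mul_nonneg hc hI)
    _ ≤ 1 := by linarith

section Exponent

variable [DecidableEq V]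

lemma le_outageExponent {P : AFProtocol V} {r b : ℝ}
    (h : ∀ᶠ ρ : ℝ in atTop, P.outageProb G s t r ρ ≤ ENNReal.ofReal (ρ ^ (-b))) :
    (b : EReal) ≤ P.outageExponent G s t r := by
  refine le_liminf_of_le (by isBoundedDefault) ?_
  filter_upwards [h, eventually_gt_atTop 1] with ρ hρ h1
  have hlog : 0 < Real.log ρ := Real.log_pos h1
  have h0 : 0 < ρ := zero_lt_one.trans h1
  rw [EReal.le_div_iff_mul_le (by exact_mod_cast hlog) (EReal.coe_ne_top _)]
  have h2 := ENNReal.log_monotone hρ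
  rw [ENNReal.log_ofReal_of_pos (by positivity), Real.log_rpow h0] at h2
  rw [EReal.le_neg]
  refine h2.trans_eq ?_
  rw [← EReal.coe_mul, ← EReal.coe_neg, neg_mul]

variable {M : ℕ} {L : Fin M → ℕ} {q : Fin M → ℕ → V} {T : ℕ} {a : ℝ} {ha : 0 < a}

/-- `edge_inj` makes every edge factor occur only once, so a moment of order `-2 * c` of the product
needs only that order for each single edge. -/
lemma exists_norm_pathsGain (hq : IsPathSystem G s t L q) (ha : 0 < a) :
    ∃ c : ℝ, 0 < c ∧ ∃ E : Finset (V × V), ∀ h : V × V → ℂ,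
      ‖pathsGain a h L q‖ = c * ∏ e ∈ E, ‖h e‖ := by
  refine ⟨∏ k, a ^ (L k - 1), Finset.prod_pos fun _ _ => by positivity,
    (Finset.univ.sigma fun k => Finset.range (L k)).image fun x => (q x.1 x.2, q x.1 (x.2 + 1)),
    fun h => ?_⟩
  rw [Finset.prod_image, Finset.prod_sigma, pathsGain, norm_prod, ← Finset.prod_mul_distrib]
  · refine Finset.prod_congr rfl fun k _ => ?_
    rw [norm_mul, norm_prod, norm_pow, Complex.norm_real, Real.norm_of_nonneg ha.le]
  · rintro ⟨k, i⟩ hi ⟨l, j⟩ hj hij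
    simp only [Finset.coe_sigma, Finset.coe_univ, Set.mem_sigma_iff, Set.mem_univ, true_and,
      Finset.coe_range, Set.mem_Iio] at hi hj
    obtain ⟨rfl, rfl⟩ := hq.edge_inj k l i hi j hj (Prod.ext_iff.1 hij).1 (Prod.ext_iff.1 hij).2
    rfl

/-- In outage, at full power in all slots, the fading on the paths is weak compared with
the noise. -/
lemma rpow_le_of_mutualInfo_lt (hq : IsPathSystem G s t L q) (hT : 0 < T) {r ρ c : ℝ}
    (hc : 0 < c) (hρ : 1 < ρ) {h : V × V → ℂ} (hg : 0 < ‖pathsGain a h L q‖)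
    (hI : (pathProtocol L q T a ha).mutualInfo G s t h ((ρ : ℂ) • 1)
      < (pathProtocol L q T a ha).duration * (r * Real.log ρ)) :
    ρ ^ (c * (M - (pathProtocol L q T a ha).duration * r / T))
      ≤ ((pathProtocol L q T a ha).noiseCov G s t h).det.re ^ (c / T)
        * ‖pathsGain a h L q‖ ^ (-(2 * c)) := by
  set P := pathProtocol L q T a ha
  obtain ⟨R, C, hR, hC, hdet⟩ : ∃ R C : Fin M × Fin T → Fin P.duration, Function.Injective R ∧
      Function.Injective C ∧ ∀ h : V × V → ℂ,
        ((P.channelMatrix G s t h).submatrix R C).det = pathsGain a h L q ^ T := exists_minor hq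
  set k := (P.noiseCov G s t h).det.re
  set γ := ‖pathsGain a h L q‖
  have hρ0 : 0 < ρ := zero_lt_one.trans hρ
  have hT' : (0 : ℝ) < T := by exact_mod_cast hT
  have hk : 1 ≤ k := one_le_noiseCov_det
  have h1 := pow_mul_norm_sq_det_le (P.noiseMatrix G s t h) (P.channelMatrix G s t h)
    (fun j => (t, j)) (noiseMatrix_sink P) R C hR hC hρ0.le
  rw [hdet h, norm_pow] at h1
  rw [mutualInfo] at hI
  change _ ≤ (P.noiseCov G s t h + _).det.re at h1
  set D := (P.noiseCov G s t h + P.channelMatrix G s t h * ((ρ : ℂ) • 1)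
    * (P.channelMatrix G s t h)ᴴ).det.re
  have h0 : 0 < ρ ^ Fintype.card (Fin M × Fin T) * (γ ^ T) ^ 2 := by positivity
  have h2 : Real.log (ρ ^ Fintype.card (Fin M × Fin T) * (γ ^ T) ^ 2) ≤ Real.log D :=
    Real.log_le_log h0 h1
  rw [Real.log_mul (by positivity) (by positivity), Real.log_pow, Real.log_pow, Real.log_pow,
    Fintype.card_prod, Fintype.card_fin, Fintype.card_fin] at h2
  push_cast at h2
  rw [Real.rpow_def_of_pos hρ0, Real.rpow_def_of_pos (zero_lt_one.trans_le hk),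
    Real.rpow_def_of_pos hg, ← Real.exp_add, Real.exp_le_exp]
  have h3 : M * T * Real.log ρ + 2 * (T * Real.log γ)
      ≤ Real.log k + P.duration * (r * Real.log ρ) := by linarith
  -- The factor `c / T` removes the `T`-fold repetition of each path and leaves the Chernoff
  -- parameter `c`.
  have h4 := mul_le_mul_of_nonneg_left h3 (div_pos hc hT').le
  have e1 : c / T * (M * T * Real.log ρ + 2 * (T * Real.log γ))
      = c * M * Real.log ρ + 2 * c * Real.log γ := by
    field_simp
  have e2 : c / T * (Real.log k + P.duration * (r * Real.log ρ))
      = Real.log k * (c / T) + c * (P.duration * r / T) * Real.log ρ := by ring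
  rw [e1, e2] at h4
  linarith

/-- Chernoff bound for the outage probability. -/
lemma exists_outageProb_le (hq : IsPathSystem G s t L q) (ha1 : a ≤ 1) (hT : 0 < T) {c : ℝ}
    (hc : 0 < c) (hc1 : c < 1) (r : ℝ) :
    ∃ B : ℝ, ∀ ρ : ℝ, 1 < ρ → (pathProtocol L q T a ha).outageProb G s t r ρ
      ≤ ENNReal.ofReal (B * ρ ^ (-(c * (M - (pathProtocol L q T a ha).duration * r / T)))) := by
  classical
  set P := pathProtocol L q T a ha
  obtain ⟨b, hb, E, hE⟩ := exists_norm_pathsGain (a := a) hq ha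
  have hT' : (0 : ℝ) < T := by exact_mod_cast hT
  set κ : ℝ := P.duration.factorial * (Fintype.card (V × Fin P.duration)) ^ P.duration with hκ
  set N : ℝ := ((P.duration * 2 * P.duration : ℕ) : ℝ) * (c / T) with hN
  have hN0 : 0 ≤ N := by positivity
  have hκ0 : 0 ≤ κ := by positivity
  -- The first factor carries the share of edge `e` in the bound on `(det K) ^ (c / T)`, the second
  -- its share in the path gain; its order is below `2` because `c < 1`.
  let φ : V × V → ℂ → ℝ≥0∞ := fun e z => ENNReal.ofReal ((1 + ‖z‖) ^ N)
    * ENNReal.ofReal ‖z‖ ^ (-(if e ∈ E then 2 * c else 0))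
  have hφ : ∀ e, Measurable (φ e) := fun e => by
    simp only [φ]
    fun_prop
  have hfin : ∫⁻ h : V × V → ℂ, ∏ e, φ e (h e) ∂(fadingLaw V) < ∞ := by
    refine lintegral_pi_prod_lt_top hφ fun e => ?_
    refine lintegral_one_add_norm_rpow_mul_lt_top hN0 ?_
    split_ifs <;> linarith
  have hbound : ∀ ρ : ℝ, 1 < ρ → ∀ h : V × V → ℂ, P.mutualInfo G s t h ((ρ : ℂ) • 1)
      < P.duration * (r * Real.log ρ) → ENNReal.ofReal (ρ ^ (c * (M - P.duration * r / T)))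
        ≤ ENNReal.ofReal (κ ^ (c / T)) * ENNReal.ofReal b ^ (-(2 * c)) * ∏ e, φ e (h e) := by
    intro ρ hρ h hI
    have hΛ := one_le_fadingBound h
    have hk1 : 1 ≤ (P.noiseCov G s t h).det.re := one_le_noiseCov_det
    have hk2 : (P.noiseCov G s t h).det.re
        ≤ κ * fadingBound h ^ (P.duration * 2 * P.duration) := by
      refine (noiseCov_det_le fun _ => ha1).trans_eq ?_
      rw [hκ, mul_pow, ← pow_mul, ← pow_mul]
      ring
    have hk3 : (P.noiseCov G s t h).det.re ^ (c / T) ≤ κ ^ (c / T) * fadingBound h ^ N := by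
      refine (Real.rpow_le_rpow (by linarith) hk2 (by positivity)).trans_eq ?_
      rw [Real.mul_rpow hκ0 (by positivity), ← Real.rpow_natCast, ← Real.rpow_mul (by linarith)]
    have hprod : ENNReal.ofReal (κ ^ (c / T)) * ENNReal.ofReal b ^ (-(2 * c)) * ∏ e, φ e (h e)
        = ENNReal.ofReal (κ ^ (c / T) * fadingBound h ^ N)
          * ENNReal.ofReal ‖pathsGain a h L q‖ ^ (-(2 * c)) := by
      have e1 : ∏ e, ENNReal.ofReal ((1 + ‖h e‖) ^ N) = ENNReal.ofReal (fadingBound h ^ N) := by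
        rw [← ENNReal.ofReal_prod_of_nonneg fun _ _ => by positivity, fadingBound,
          Real.finsetProd_rpow _ _ fun _ _ => by positivity]
      have e2 : ∏ e, ENNReal.ofReal ‖h e‖ ^ (-(if e ∈ E then 2 * c else 0))
          = (∏ e ∈ E, ENNReal.ofReal ‖h e‖) ^ (-(2 * c)) := by
        rw [← ENNReal.prod_rpow_of_ne_top fun _ _ => ENNReal.ofReal_ne_top,
          ← Finset.prod_subset (Finset.subset_univ E)]
        · exact Finset.prod_congr rfl fun e he => by rw [if_pos he]
        · intro e _ he
          rw [if_neg he, neg_zero, ENNReal.rpow_zero]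
      simp only [φ]
      rw [Finset.prod_mul_distrib, e1, e2, hE h, ENNReal.ofReal_mul hb.le,
        ENNReal.ofReal_prod_of_nonneg fun _ _ => norm_nonneg _,
        ENNReal.mul_rpow_of_ne_top ENNReal.ofReal_ne_top
          (ENNReal.prod_ne_top fun _ _ => ENNReal.ofReal_ne_top),
        ENNReal.ofReal_mul (by positivity)]
      ring
    rw [hprod]
    -- For vanishing path gain the negative power is `∞` in `ℝ≥0∞`, and the bound is trivial.
    rcases (norm_nonneg (pathsGain a h L q)).eq_or_lt with hg | hg
    · rw [← hg, ENNReal.ofReal_zero, ENNReal.zero_rpow_of_neg (by linarith), ENNReal.mul_top]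
      · exact le_top
      · exact (ENNReal.ofReal_pos.2
          ((Real.rpow_pos_of_pos (zero_lt_one.trans_le hk1) _).trans_le hk3)).ne'
    · rw [ENNReal.ofReal_rpow_of_pos hg, ← ENNReal.ofReal_mul (by positivity)]
      refine ENNReal.ofReal_le_ofReal
        ((rpow_le_of_mutualInfo_lt hq hT hc hρ hg hI).trans ?_)
      exact mul_le_mul_of_nonneg_right hk3 (by positivity)
  have hB : ENNReal.ofReal (κ ^ (c / T)) * ENNReal.ofReal b ^ (-(2 * c))
      * ∫⁻ h : V × V → ℂ, ∏ e, φ e (h e) ∂(fadingLaw V) ≠ ∞ := by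
    refine ENNReal.mul_ne_top (ENNReal.mul_ne_top ENNReal.ofReal_ne_top ?_) hfin.ne
    rw [ENNReal.ofReal_rpow_of_pos hb]
    exact ENNReal.ofReal_ne_top
  refine ⟨(ENNReal.ofReal (κ ^ (c / T)) * ENNReal.ofReal b ^ (-(2 * c))
      * ∫⁻ h : V × V → ℂ, ∏ e, φ e (h e) ∂(fadingLaw V)).toReal, fun ρ hρ => ?_⟩
  have hρ0 : 0 < ρ := zero_lt_one.trans hρ
  have hS : ((ρ : ℂ) • 1 : Matrix (Fin P.duration) (Fin P.duration) ℂ) ∈ P.inputCovs ρ := by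
    constructor
    · exact Matrix.PosSemidef.one.smul (by exact_mod_cast hρ0.le)
    · simp [mul_comm]
  have hpow : 0 < ρ ^ (c * (M - P.duration * r / T)) := by positivity
  have hm : Measurable fun h : V × V → ℂ => ∏ e, φ e (h e) :=
    Finset.measurable_fun_prod _ fun e _ => (hφ e).comp (measurable_pi_apply e)
  calc P.outageProb G s t r ρ
      ≤ fadingLaw V {h | P.mutualInfo G s t h ((ρ : ℂ) • 1)
          < P.duration * (r * Real.log ρ)} := iInf₂_le _ hS
    _ ≤ fadingLaw V {h | ENNReal.ofReal (ρ ^ (c * (M - P.duration * r / T)))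
          ≤ ENNReal.ofReal (κ ^ (c / T)) * ENNReal.ofReal b ^ (-(2 * c)) * ∏ e, φ e (h e)} :=
        measure_mono fun h hI => hbound ρ hρ h hI
    _ ≤ (∫⁻ h, ENNReal.ofReal (κ ^ (c / T)) * ENNReal.ofReal b ^ (-(2 * c))
          * ∏ e, φ e (h e) ∂(fadingLaw V))
            / ENNReal.ofReal (ρ ^ (c * (M - P.duration * r / T))) :=
        meas_ge_le_lintegral_div (hm.const_mul _).aemeasurable (ENNReal.ofReal_pos.2 hpow).ne'
          ENNReal.ofReal_ne_top
    _ = _ := by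
        rw [lintegral_const_mul _ hm, Real.rpow_neg hρ0.le,
          ← div_eq_mul_inv, ENNReal.ofReal_div_of_pos hpow, ENNReal.ofReal_toReal hB]

/-- The strict gap in `hb` yields a negative power of `ρ` that absorbs the constant `B`. -/
lemma le_outageExponent_pathProtocol (hq : IsPathSystem G s t L q) (ha1 : a ≤ 1) (hT : 0 < T)
    {c : ℝ} (hc : 0 < c) (hc1 : c < 1) {r b : ℝ}
    (hb : b < c * (M - (pathProtocol L q T a ha).duration * r / T)) :
    (b : EReal) ≤ (pathProtocol L q T a ha).outageExponent G s t r := by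
  obtain ⟨B, hB⟩ := exists_outageProb_le (ha := ha) hq ha1 hT hc hc1 r
  set x := c * (M - (pathProtocol L q T a ha).duration * r / T)
  apply le_outageExponent
  have h1 := (tendsto_rpow_neg_atTop (sub_pos.2 hb)).const_mul B
  rw [mul_zero] at h1
  filter_upwards [eventually_gt_atTop 1, h1.eventually_le_const one_pos] with ρ hρ h2
  have hρ0 : 0 < ρ := zero_lt_one.trans hρ
  refine (hB ρ hρ).trans (ENNReal.ofReal_le_ofReal ?_)
  have h3 : ρ ^ (-x) = ρ ^ (-(x - b)) * ρ ^ (-b) := by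
    rw [← Real.rpow_add hρ0]
    ring_nf
  rw [h3, ← mul_assoc]
  exact mul_le_of_le_one_left (by positivity) h2

/-- Probabilities are at most `1`; this settles the range `r > 1`. -/
lemma neg_le_outageExponent (P : AFProtocol V) {ε : ℝ} (hε : 0 < ε) (r : ℝ) :
    ((-ε : ℝ) : EReal) ≤ P.outageExponent G s t r := by
  have : IsProbabilityMeasure (fadingLaw V) := by
    unfold fadingLaw
    infer_instance
  apply le_outageExponent
  filter_upwards [eventually_ge_atTop 1] with ρ hρ
  have h0 : (0 : Matrix (Fin P.duration) (Fin P.duration) ℂ) ∈ P.inputCovs ρ :=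
    ⟨Matrix.PosSemidef.zero, by simpa using mul_nonneg (Nat.cast_nonneg _) (by linarith)⟩
  calc P.outageProb G s t r ρ ≤ _ := iInf₂_le _ h0
    _ ≤ 1 := prob_le_one
    _ ≤ ENNReal.ofReal (ρ ^ (-(-ε))) := by
      rw [ENNReal.one_le_ofReal, neg_neg]
      exact Real.one_le_rpow hρ hε.le

end Exponent

end AFProtocol

/-! ### Path systems: achievability and existence -/

section

variable {V : Type*} [Fintype V] {G : Digraph V} {s t : V}

/-- The linear tradeoff is achieved by activating a system of paths one after the other. -/
theorem AFProtocol.IsPathSystem.isAchievableByAF [DecidableEq V] {M : ℕ} {L : Fin M → ℕ} {q : Fin M → ℕ → V}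
    (hq : AFProtocol.IsPathSystem G s t L q) :
    IsAchievableByAF G s t fun r => (M : ℝ) * max (1 - r) 0 := by
  intro ε hε
  -- Half of `ε` pays for the overhead of `M * |V| + 1` slots relative to `T`, the other half for
  -- `(1 - c) * M`.
  obtain ⟨T, hT⟩ := exists_nat_gt (2 * (M * Fintype.card V + 1) / ε)
  have hT' : (0 : ℝ) < T := lt_of_le_of_lt (by positivity) hT
  obtain ⟨a, ha, ha1, hE⟩ := AFProtocol.exists_gain (V := V) (M * (T + Fintype.card V) + 1)
  refine ⟨AFProtocol.pathProtocol L q T a ha,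
    AFProtocol.meetsEnergyConstraint_of_le ha1 (fun _ => rfl) hE, fun r hr => ?_⟩
  rcases le_or_gt r 1 with h1 | h1
  · set c : ℝ := 1 - ε / (2 * M + 2 + ε) with hc
    have hd : 0 < 2 * (M : ℝ) + 2 + ε := by positivity
    have hδ : ε / (2 * M + 2 + ε) < 1 := by rw [div_lt_one hd]; linarith [Nat.cast_nonneg (α := ℝ) M]
    have hδ0 : 0 < ε / (2 * M + 2 + ε) := by positivity
    have hδM : ε / (2 * M + 2 + ε) * M < ε / 2 := by
      rw [div_mul_eq_mul_div, div_lt_div_iff₀ hd two_pos]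
      nlinarith
    refine AFProtocol.le_outageExponent_pathProtocol hq ha1 (by exact_mod_cast hT')
      (c := c) (by linarith) (by linarith) ?_
    beta_reduce
    rw [max_eq_left (by linarith)]
    have hdur : ((AFProtocol.pathProtocol L q T a ha).duration : ℝ)
        = M * T + (M * Fintype.card V + 1) := by
      simp only [AFProtocol.pathProtocol]
      push_cast
      ring
    set K : ℝ := M * Fintype.card V + 1
    have hK : 0 < K := by positivity
    have hKT : K / T < ε / 2 := by
      rw [div_lt_iff₀ hε] at hT
      rw [div_lt_div_iff₀ hT' two_pos]
      linarith
    have h2 : (M : ℝ) - (M * T + K) * r / T = M * (1 - r) - K / T * r := by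
      field_simp
      ring
    rw [hdur, h2]
    have hKT0 : 0 < K / T := by positivity
    set δ := ε / (2 * M + 2 + ε)
    have hM0 : (0 : ℝ) ≤ M := Nat.cast_nonneg M
    have h3 : c * (M * (1 - r) - K / T * r)
        = M * (1 - r) - δ * M * (1 - r) - c * (K / T * r) := by
      rw [hc]
      ring
    have h4 : δ * M * (1 - r) ≤ δ * M := mul_le_of_le_one_right (by positivity) (by linarith)
    have h5 : c * (K / T * r) ≤ K / T := by
      have : K / T * r ≤ K / T := mul_le_of_le_one_right hKT0.le h1
      have h6 : 0 ≤ K / T * r := mul_nonneg hKT0.le hr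
      nlinarith
    linarith
  · have h2 : (M : ℝ) * max (1 - r) 0 - ε = -ε := by
      rw [max_eq_right (by linarith)]
      ring
    rw [h2]
    exact AFProtocol.neg_le_outageExponent _ hε r

/-- Edge-disjoint paths that have no shortcuts, or that lie in a graph without cycles, form
a path system. -/
lemma exists_isPathSystem (hst : s ≠ t) {M : ℕ} {p : Fin M → List V}
    (hp : ∀ i, IsDiPath G s t (p i))
    (hdis : ∀ i j, i ≠ j → List.Disjoint (pathEdges (p i)) (pathEdges (p j)))
    (hG : IsDiAcyclic G ∨ ∀ i, ¬ HasShortcut G (p i)) :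
    ∃ (L : Fin M → ℕ) (q : Fin M → ℕ → V), AFProtocol.IsPathSystem G s t L q := by
  have hlen : ∀ k, 2 ≤ (p k).length := by
    intro k
    obtain ⟨-, -, h1, h2⟩ := hp k
    rcases hpk : p k with _ | ⟨u, _ | ⟨v, l⟩⟩
    · simp [hpk] at h1
    · simp only [hpk, List.head?_cons, Option.some.injEq, List.getLast?_singleton] at h1 h2
      exact absurd (h1.symm.trans h2) hst
    · simp
  have hget : ∀ k j, (hj : j ≤ (p k).length - 1) →
      (p k).getD j s = (p k)[j]'(by have := hlen k; omega) := by
    intro k j hj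
    have := hlen k
    exact List.getD_eq_getElem _ _ (by omega)
  have hadj : ∀ k, ∀ i < (p k).length - 1, G.Adj ((p k).getD i s) ((p k).getD (i + 1) s) := by
    intro k i hi
    rw [hget k i hi.le, hget k (i + 1) (by omega)]
    exact List.isChain_iff_getElem.1 (hp k).1 i (by omega)
  have hinj : ∀ k, ∀ i ≤ (p k).length - 1, ∀ j ≤ (p k).length - 1,
      (p k).getD i s = (p k).getD j s → i = j := by
    intro k i hi j hj hij
    rw [hget k i hi, hget k j hj] at hij
    exact ((hp k).2.1.getElem_inj_iff).1 hij
  have hmem : ∀ k, ∀ i < (p k).length - 1,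
      ((p k).getD i s, (p k).getD (i + 1) s) ∈ pathEdges (p k) := by
    intro k i hi
    rw [hget k i hi.le, hget k (i + 1) (by omega), pathEdges, List.mem_iff_getElem]
    exact ⟨i, by simp; omega, by simp⟩
  refine ⟨fun k => (p k).length - 1, fun k j => (p k).getD j s, ?_, ?_, ?_, ?_, hinj, hadj, ?_, ?_⟩
  · intro k
    have := hlen k
    omega
  · intro k
    have := hlen k
    have := (hp k).2.1.length_le_card
    omega
  · intro k
    have h1 := (hp k).2.2.1
    have := hlen k
    rw [List.head?_eq_getElem?, List.getElem?_eq_getElem (by omega)] at h1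
    rw [hget k 0 (by omega)]
    exact Option.some.inj h1
  · intro k
    have h1 := (hp k).2.2.2
    have := hlen k
    rw [List.getLast?_eq_getElem?, List.getElem?_eq_getElem (by omega)] at h1
    rw [hget k _ le_rfl]
    exact Option.some.inj h1
  · intro k l i hi j hj h1 h2
    have hkl : k = l := by
      by_contra hne
      refine hdis k l hne (hmem k i hi) ?_
      rw [h1, h2]
      exact hmem l j hj
    subst hkl
    exact ⟨rfl, hinj k i hi.le j hj.le h1⟩
  · refine hG.imp (fun hac k i hi j hj hA => ?_) fun hns k i hi j hj hA => ?_
    -- An edge to the same or an earlier position would close a cycle with the path segment in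
    -- between.
    · by_contra hle
      have h1 : ∀ d, i + d ≤ (p k).length - 1 →
          Relation.ReflTransGen G.Adj ((p k).getD i s) ((p k).getD (i + d) s) := by
        intro d
        induction d with
        | zero => exact fun _ => Relation.ReflTransGen.refl
        | succ d ih => exact fun hd => (ih (by omega)).tail (hadj k (i + d) (by omega))
      have h2 := h1 (j - i) (by omega)
      rw [show i + (j - i) = j by omega] at h2
      exact hac _ (Relation.TransGen.tail' h2 hA)
    · by_contra hle
      have := hlen k
      rw [hget k i hi, hget k j hj] at hA
      exact hns k ⟨⟨j, by omega⟩, ⟨i, by omega⟩, by simp only; omega, hA⟩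

end

theorem mainTheorem3 {V : Type*} [Fintype V] [DecidableEq V] (G : Digraph V) (s t : V)
    (hst : s ≠ t) (M : ℕ) (hM : IsMinCut G s t M)
    (hG : IsDiAcyclic G ∨
      ∃ p : Fin M → List V, (∀ i, IsDiPath G s t (p i)) ∧
        (∀ i j, i ≠ j → List.Disjoint (pathEdges (p i)) (pathEdges (p j))) ∧
        ∀ i, ¬ HasShortcut G (p i)) :
    IsAchievableByAF G s t (fun r => (M : ℝ) * max (1 - r) 0) := by
  obtain ⟨p, hp, hdis, hG'⟩ : ∃ p : Fin M → List V, (∀ i, IsDiPath G s t (p i)) ∧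
      (∀ i j, i ≠ j → List.Disjoint (pathEdges (p i)) (pathEdges (p j))) ∧
      (IsDiAcyclic G ∨ ∀ i, ¬ HasShortcut G (p i)) := by
    rcases hG with h | ⟨p, h1, h2, h3⟩
    · obtain ⟨p, h1, h2⟩ := exists_edgeDisjoint_paths hM
      exact ⟨p, h1, h2, Or.inl h⟩
    · exact ⟨p, h1, h2, Or.inr h3⟩
  obtain ⟨L, q, hq⟩ := exists_isPathSystem hst hp hdis hG'
  exact hq.isAchievableByAF
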